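/- Let $K$ be a field of characteristic zero. For a finite set $I$ put $P_I=K[t_i\mid i\in I]/(1-\sum_i t_i)$, $W_I=K\{dt_i\mid i\in I\}/(\sum_i dt_i)$, $W_I^\vee=\mathrm{Hom}_K(W_I,K)$, $\Omega_I^m=P_I\otimes_K\Lambda^m(W_I)$ with the de Rham differential $d(f\omega_0)=df\wedge\omega_0$, and $\widehat\Phi_{I,m}=\mathrm{Hom}_K(\Omega_I^m,K)$ with the differential $\widehat\delta(\phi)=(-1)^{m+1}\phi\circ d$ for $\phi\in\widehat\Phi_{I,m+1}$. A map $\sigma\colon I\to J$ of finite sets induces $\sigma^*\colon\Omega^m_J\to\Omega^m_I$ by $t_j\mapsto\sum_{\sigma(i)=j}t_i$, $dt_j\mapsto\sum_{\sigma(i)=j}dt_i$; for an inclusion it is called restriction, $\mathrm{res}$. Put $$\Theta_{I,m}=P_I\otimes_K\Lambda^m(W_I^\vee),\qquad \Phi_{I,m}=\bigoplus_{\emptyset\ne J\subseteq I}\Theta_{J,m},$$ with inclusions $i_J\colon\Theta_{J,m}\to\Phi_{I,m}$. Let $\langle\ ,\ \rangle\colon\Theta_{I,m}\times\Omega^m_I\to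 P_I$ be the $P_I$-bilinear pairing with $\langle\alpha_1\wedge\dots\wedge\alpha_m,\omega_1\wedge\dots\wedge\omega_m\rangle=(-1)^{m(m-1)/2}\det(\langle\alpha_i,\omega_j\rangle)$. For $I\neq\emptyset$ let $\int_I\colon P_I\to K$ be the linear map with $\int_I t^\nu=\prod_i\nu_i!\,/\,(|I|-1+\sum_i\nu_i)!$. Define $\xi_I\colon\Phi_{I,m}\to\widehat\Phi_{I,m}$ by $\xi_I(i_J(\alpha))(\omega)=\int_J\langle\alpha,\mathrm{res}^I_J(\omega)\rangle$. For a finite-dimensional vector space $V$ and $u\in V$, let $u\lrcorner(-)\colon\Lambda^{m+1}(V^\vee)\to\Lambda^m(V^\vee)$ be the restriction of the antiderivation of $\Lambda^*(V^\vee)$ with $u\lrcorner a=-a(u)$ for $a\in V^\vee$; extend it $P_J$-linearly in the case $V=W_J$. For $f\in P_J$ and $\alpha_0\in\Lambda^{m+1}(W_J^\vee)$ put $$\delta(i_J(f\alpha_0))=-i_J(df\lrcorner\alpha_0)-\sum_{j\in J}i_{J\setminus\{j\}}\bigl(\mathrm{res}^J_{J\setminus\{j\}}(f)\,dt_j\lrcorner\alpha_0\bigr),$$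 where $dt_j\lrcorner\alpha_0$ is regarded as an element of $\Lambda^m(W_{J\setminus\{j\}}^\vee)\subseteq\Lambda^m(W_J^\vee)$ and terms with $J\setminus\{j\}=\emptyset$ are $0$. This defines $\delta\colon\Phi_{I,m+1}\to\Phi_{I,m}$. For a surjection $\sigma\colon I\to J$ let $\sigma_*\colon P_I\to P_J$ be the linear map with $t^\nu/\nu!\mapsto t^\mu/\mu!$, where $\mu_j=-1+\sum_{\sigma(i)=j}(\nu_i+1)$, and let $\sigma_*\colon\Theta_{I,m}\to\Theta_{J,m}$ be its tensor product with the map $\Lambda^m(W_I^\vee)\to\Lambda^m(W_J^\vee)$ dual to $\sigma^*$. For an arbitrary map $\sigma\colon I\to J$ of finite sets define $\sigma_*\colon\Phi_{I,m}\to\Phi_{J,m}$ by $\sigma_*(i_A(\alpha))=i_{\sigma(A)}((\sigma|_A)_*(\alpha))$, where $\sigma|_A\colon A\to\sigma(A)$. Then: (a) For every finite set $I$, $(\widehat\Phi_{I,*},\widehat\delta)$ is a chain complex, the map $\xi_I$ is injective in every degree, its image is a subcomplex of $\widehat\Phi_{I,*}$, and $\xi_I\delta=\widehat\delta\xi_I$.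 (b) $(\Phi_{I,*},\delta)$ is a chain complex, and with the maps $\sigma_*$ it is a covariant functor from finite sets to chain complexes over $K$. The maps $\xi_I$ are natural, i.e. $\xi_J(\sigma_*\alpha)(\omega)=\xi_I(\alpha)(\sigma^*\omega)$. The map $\sigma_*\colon\Phi_{I,*}\to\Phi_{J,*}$ is a quasi-isomorphism for every map $\sigma\colon I\to J$ of finite sets, except when $I=\emptyset\neq J$. (c) If $I=\{i\}$ is a singleton, then $\Phi_{I,*}$ is $K$ concentrated in degree $0$: the map $K\to\Phi_{I,0}$, $c\mapsto c\cdot i_{\{i\}}(1)$, is bijective, and $\Phi_{I,m}=0$ for $m\neq0$. -/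

import Mathlib

universe u v

noncomputable section

namespace DeRhamChains

open scoped TensorProduct Nat
open MvPolynomial

variable (K : Type u) [Field K] {I : Type v} [Fintype I]

/-! ### Polynomial functions and differential forms on the algebraic simplex -/

variable (I) in
/-- The ideal `(1 - ∑ i, t_i)` of `K[t_i | i ∈ I]`. -/
abbrev simplexIdeal : Ideal (MvPolynomial I K) :=
  Ideal.span {1 - ∑ i : I, X i}

variable (I) in
/-- The ring `P_I = K[t_i | i ∈ I] / (1 - ∑ i, t_i)`. -/
def P : Type (max u v) :=
  MvPolynomial I K ⧸ simplexIdeal K I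

instance : CommRing (P K I) :=
  inferInstanceAs (CommRing (MvPolynomial I K ⧸ simplexIdeal K I))

instance : Algebra K (P K I) :=
  inferInstanceAs (Algebra K (MvPolynomial I K ⧸ simplexIdeal K I))

instance : Algebra (MvPolynomial I K) (P K I) :=
  inferInstanceAs (Algebra (MvPolynomial I K) (MvPolynomial I K ⧸ simplexIdeal K I))

instance : IsScalarTower K (MvPolynomial I K) (P K I) :=
  inferInstanceAs (IsScalarTower K (MvPolynomial I K) (MvPolynomial I K ⧸ simplexIdeal K I))

variable (I) in
/-- The quotient map `K[t_i | i ∈ I] → P_I`. -/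
def P.mk : MvPolynomial I K →ₐ[K] P K I :=
  Ideal.Quotient.mkₐ K (simplexIdeal K I)

theorem P.mk_relation_mul (p : MvPolynomial I K) :
    P.mk K I ((1 - ∑ i : I, X i) * p) = 0 :=
  Ideal.Quotient.eq_zero_iff_mem.2
    (Ideal.mul_mem_right _ _ (Ideal.mem_span_singleton_self _))

variable {K} in
/-- A `K`-linear map on `K[t_i | i ∈ I]` that kills all multiples of `1 - ∑ i, t_i`
descends to `P_I`. -/
def P.lift {M : Type*} [AddCommGroup M] [Module K M] (f : MvPolynomial I K →ₗ[K] M)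
    (hf : ∀ p, f ((1 - ∑ i : I, X i) * p) = 0) : P K I →ₗ[K] M :=
  ((simplexIdeal K I).restrictScalars K).liftQ f (by
    intro p hp
    obtain ⟨q, rfl⟩ := Ideal.mem_span_singleton'.1 hp
    rw [LinearMap.mem_ker, mul_comm]
    exact hf q) ∘ₗ
  (Submodule.Quotient.restrictScalarsEquiv K (simplexIdeal K I)).symm.toLinearMap

theorem P.lift_mk {M : Type*} [AddCommGroup M] [Module K M] (f : MvPolynomial I K →ₗ[K] M)
    (hf : ∀ p, f ((1 - ∑ i : I, X i) * p) = 0) (p : MvPolynomial I K) :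
    P.lift f hf (P.mk K I p) = f p :=
  rfl

variable (I) in
/-- `W_I = K{dt_i | i ∈ I} / (∑ i, dt_i)`; a function `w : I → K` stands for `∑ i, w i • dt_i`,
so that `∑ i, dt_i` is the constant function `1`. -/
abbrev W : Type (max u v) :=
  (I → K) ⧸ Submodule.span K {(1 : I → K)}

open scoped Classical in
/-- The class of `dt_i` in `W_I`. -/
def dt (i : I) : W K I :=
  Submodule.Quotient.mk (Pi.single i 1)

variable (I) in
/-- `Ω^m_I = P_I ⊗ Λ^m(W_I)`. -/
abbrev Om (m : ℕ) : Type (max u v) :=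
  P K I ⊗[K] ⋀[K]^m (W K I)

theorem sum_dt : ∑ i : I, dt K i = 0 := by
  classical
  have h : ∑ i : I, dt K i = (Submodule.span K {(1 : I → K)}).mkQ (∑ i, Pi.single i 1) := by
    rw [map_sum]
    refine Finset.sum_congr rfl fun i _ => ?_
    unfold dt
    congr
  rw [h, Finset.univ_sum_single (fun _ : I => (1 : K))]
  exact (Submodule.Quotient.mk_eq_zero _).2 (Submodule.mem_span_singleton_self _)

variable (I) in
/-- The differential of functions, `f ↦ df = ∑ i, (∂f/∂t_i) dt_i`, on polynomials. -/
def dPoly : Derivation K (MvPolynomial I K) (P K I ⊗[K] W K I) :=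
  mkDerivation K fun i => (1 : P K I) ⊗ₜ[K] dt K i

variable (I) in
/-- The differential of functions `d : P_I → Ω^1_I = P_I ⊗ W_I`. -/
def dFun : P K I →ₗ[K] P K I ⊗[K] W K I :=
  P.lift (dPoly K I).toLinearMap (by
    intro p
    have h0 : ∀ x : P K I ⊗[K] W K I, (1 - ∑ i : I, X i : MvPolynomial I K) • x = 0 := by
      intro x
      induction x with
      | zero => exact smul_zero _
      | add x y hx hy => rw [smul_add, hx, hy, add_zero]
      | tmul f w =>
        rw [TensorProduct.smul_tmul', Algebra.smul_def]
        have h : algebraMap (MvPolynomial I K) (P K I) (1 - ∑ i : I, X i) = 0 := by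
          have := P.mk_relation_mul K (1 : MvPolynomial I K)
          rwa [mul_one] at this
        rw [h, zero_mul, TensorProduct.zero_tmul]
    change dPoly K I _ = 0
    have h1 : dPoly K I (1 - ∑ i : I, X i) = 0 := by
      rw [map_sub, Derivation.map_one_eq_zero, map_sum]
      simp only [dPoly, mkDerivation_X]
      rw [← TensorProduct.tmul_sum, sum_dt, TensorProduct.tmul_zero, sub_zero]
    rw [Derivation.leibniz, h0, h1, smul_zero, add_zero])

/-- Left multiplication `w ∧ -` from `Λ^m(V)` to `Λ^{m+1}(V)`. -/
def wedge (V : Type*) [AddCommGroup V] [Module K V] (m : ℕ) :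
    V →ₗ[K] ⋀[K]^m V →ₗ[K] ⋀[K]^(m + 1) V :=
  LinearMap.mk₂ K
    (fun v x => ⟨ExteriorAlgebra.ι K v * x.1, by
      rw [ExteriorAlgebra.exteriorPower, pow_succ']
      exact Submodule.mul_mem_mul (LinearMap.mem_range_self _ v) x.2⟩)
    (fun v v' x => Subtype.ext (by simp [add_mul]))
    (fun c v x => Subtype.ext (by simp))
    (fun v x x' => Subtype.ext (by simp [mul_add]))
    (fun c v x => Subtype.ext (by simp))

variable (I) in
/-- The de Rham differential `Ω^m_I → Ω^{m+1}_I`, `f ω₀ ↦ df ∧ ω₀`. -/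
def deRham (m : ℕ) : Om K I m →ₗ[K] Om K I (m + 1) :=
  TensorProduct.map LinearMap.id (TensorProduct.lift (wedge K (W K I) m)) ∘ₗ
    (TensorProduct.assoc K (P K I) (W K I) (⋀[K]^m (W K I))).toLinearMap ∘ₗ
    TensorProduct.map (dFun K I) LinearMap.id

/-! ### Contravariant functoriality -/

section Pullback

variable {J : Type v} [Fintype J] (σ : I → J)

open scoped Classical in
/-- The homomorphism `K[t_j | j ∈ J] → K[t_i | i ∈ I]`, `t_j ↦ ∑_{σ i = j} t_i`. -/
def polyPullback : MvPolynomial J K →ₐ[K] MvPolynomial I K :=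
  aeval fun j => ∑ i : I with σ i = j, X i

/-- The ring map `σ^* : P_J → P_I`. -/
def pPullback : P K J →ₐ[K] P K I :=
  Ideal.quotientMapₐ (simplexIdeal K I) (polyPullback K σ) (by
    classical
    rw [Ideal.span_le, Set.singleton_subset_iff]
    have : polyPullback K σ (1 - ∑ j : J, X j) = 1 - ∑ i : I, X i := by
      simp only [polyPullback, map_sub, map_one, map_sum, aeval_X]
      rw [Finset.sum_fiberwise Finset.univ σ fun i => (X i : MvPolynomial I K)]
    change polyPullback K σ (1 - ∑ j : J, X j) ∈ simplexIdeal K I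
    rw [this]
    exact Ideal.mem_span_singleton_self _)

/-- The map `σ^* : W_J → W_I`, `dt_j ↦ ∑_{σ i = j} dt_i`; on functions it is `w ↦ w ∘ σ`. -/
def wPullback : W K J →ₗ[K] W K I :=
  Submodule.mapQ _ _ (LinearMap.funLeft K K σ) (by
    rw [Submodule.span_le, Set.singleton_subset_iff]
    exact Submodule.mem_span_singleton_self _)

/-- The map `σ^* : Ω^m_J → Ω^m_I`. -/
def omPullback (m : ℕ) : Om K J m →ₗ[K] Om K I m :=
  TensorProduct.map (pPullback K σ).toLinearMap (exteriorPower.map m (wPullback K σ))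

end Pullback

/-! ### The dual complex -/

variable (I) in
/-- `Hom_K(Ω^m_I, K)`. -/
abbrev HatPhi (m : ℕ) : Type (max u v) :=
  Module.Dual K (Om K I m)

variable (I) in
/-- The differential of the dual complex, `φ ↦ (-1)^{m+1} φ ∘ d` on `Hom_K(Ω^{m+1}_I, K)`. -/
def hatDelta (m : ℕ) : HatPhi K I (m + 1) →ₗ[K] HatPhi K I m :=
  (-1 : K) ^ (m + 1) • (deRham K I m).dualMap

/-! ### The graded vector spaces `Θ` and `Φ` -/

variable (I) in
/-- `W_I^∨ = Hom_K(W_I, K)`. -/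
abbrev WDual : Type (max u v) :=
  Module.Dual K (W K I)

variable (I) in
/-- `Θ_{I,m} = P_I ⊗ Λ^m(W_I^∨)`. -/
abbrev Tht (m : ℕ) : Type (max u v) :=
  P K I ⊗[K] ⋀[K]^m (WDual K I)

variable (I) in
/-- The nonempty subsets of `I`. -/
abbrev NESub : Type v :=
  {J : Finset I // J.Nonempty}

instance (J : NESub I) : Nonempty J.1 :=
  J.2.to_subtype

variable (I) in
/-- `Φ_{I,m}`, the direct sum of `Θ_{J,m}` over all nonempty subsets `J` of `I`. -/
abbrev Phi (m : ℕ) : Type (max u v) :=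
  DirectSum (NESub I) fun J => Tht K J.1 m

open scoped Classical in
/-- The inclusion `i_J : Θ_{J,m} → Φ_{I,m}`. -/
def incl (J : NESub I) (m : ℕ) : Tht K J.1 m →ₗ[K] Phi K I m :=
  DirectSum.lof K (NESub I) (fun J => Tht K J.1 m) J

open scoped Classical in
variable {K} in
/-- The linear map on `Φ_{I,m}` with prescribed composites with the inclusions `i_J`. -/
def Phi.desc {m : ℕ} {M : Type*} [AddCommMonoid M] [Module K M]
    (f : (J : NESub I) → Tht K J.1 m →ₗ[K] M) : Phi K I m →ₗ[K] M :=
  DirectSum.toModule K (NESub I) M f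

/-! ### Pairings -/

variable (I) in
/-- The pairing of `Λ^m(W_I^∨)` with `Λ^m(W_I)`,
`⟨α₁ ∧ ⋯ ∧ α_m, ω₁ ∧ ⋯ ∧ ω_m⟩ = (-1)^{m(m-1)/2} det ⟨α_i, ω_j⟩`. -/
def extPairing (m : ℕ) : ⋀[K]^m (WDual K I) →ₗ[K] ⋀[K]^m (W K I) →ₗ[K] K :=
  (-1 : K) ^ (m * (m - 1) / 2) • exteriorPower.pairingDual K (W K I) m

variable (I) in
/-- The `P_I`-bilinear extension `⟨f α₀, g ω₀⟩ = ⟨α₀, ω₀⟩ f g` of the previous pairing, from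
`Θ_{I,m}` and `Ω^m_I` to `P_I`. -/
def thtPairing (m : ℕ) : Tht K I m →ₗ[K] Om K I m →ₗ[K] P K I :=
  (TensorProduct.map₂ (LinearMap.mul K (P K I)) (extPairing K I m)).compr₂
    (TensorProduct.rid K (P K I)).toLinearMap

variable (I) in
/-- The linear map `∫_I` on polynomials: `t^ν ↦ (∏ i, ν_i!) / (|I| - 1 + ∑ i, ν_i)!`. It is only
used for nonempty `I`. -/
def polyInt : MvPolynomial I K →ₗ[K] K :=
  (basisMonomials I K).constr K fun ν : I →₀ ℕ =>
    ((∏ i : I, (ν i)! : ℕ) : K) / ((Fintype.card I - 1 + ∑ i : I, ν i)! : K)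

theorem prod_factorial_add_single (ν : I →₀ ℕ) (i : I) :
    ∏ k : I, ((Finsupp.single i 1 + ν : I →₀ ℕ) k)! = (ν i + 1) * ∏ k : I, (ν k)! := by
  classical
  rw [← Finset.mul_prod_erase _ _ (Finset.mem_univ i),
    ← Finset.mul_prod_erase _ (fun k => (ν k)!) (Finset.mem_univ i)]
  have : ∏ k ∈ Finset.univ.erase i, ((Finsupp.single i 1 + ν : I →₀ ℕ) k)! =
      ∏ k ∈ Finset.univ.erase i, (ν k)! := by
    refine Finset.prod_congr rfl fun k hk => ?_
    simp [(Finset.ne_of_mem_erase hk).symm]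
  rw [this, ← mul_assoc]
  simp [add_comm 1, Nat.factorial_succ]

theorem one_sub_sum_X_mul_monomial (ν : I →₀ ℕ) :
    (1 - ∑ i : I, X i) * monomial ν (1 : K) =
      monomial ν 1 - ∑ i : I, monomial (Finsupp.single i 1 + ν) 1 := by
  rw [sub_mul, one_mul, Finset.sum_mul]
  simp only [X, monomial_mul, one_mul]

theorem polyInt_monomial (ν : I →₀ ℕ) :
    polyInt K I (monomial ν 1) =
      ((∏ i : I, (ν i)! : ℕ) : K) / ((Fintype.card I - 1 + ∑ i : I, ν i)! : K) := by
  have := (basisMonomials I K).constr_basis K (fun ν : I →₀ ℕ =>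
    ((∏ i : I, (ν i)! : ℕ) : K) / ((Fintype.card I - 1 + ∑ i : I, ν i)! : K)) ν
  rwa [coe_basisMonomials] at this

theorem polyInt_mul [CharZero K] [Nonempty I] (p : MvPolynomial I K) :
    polyInt K I ((1 - ∑ i : I, X i) * p) = 0 := by
  have key : polyInt K I ∘ₗ LinearMap.mulLeft K (1 - ∑ i : I, X i) = 0 := by
    refine (basisMonomials I K).ext fun ν => ?_
    rw [coe_basisMonomials, LinearMap.comp_apply, LinearMap.mulLeft_apply,
      one_sub_sum_X_mul_monomial, map_sub, map_sum, LinearMap.zero_apply, sub_eq_zero]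
    simp only [polyInt_monomial, prod_factorial_add_single]
    have hc : 1 ≤ Fintype.card I := Fintype.card_pos
    have hs (i : I) : Fintype.card I - 1 + ∑ k : I, (Finsupp.single i 1 + ν : I →₀ ℕ) k =
        (Fintype.card I - 1 + ∑ k : I, ν k) + 1 := by
      have : ∑ k : I, (Finsupp.single i 1 : I →₀ ℕ) k = 1 := by
        classical
        simp [Finsupp.single_apply]
      simp only [Finsupp.add_apply, Finset.sum_add_distrib, this]
      omega
    have ht : (Fintype.card I - 1 + ∑ k : I, ν k) + 1 = ∑ k : I, (ν k + 1) := by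
      simp only [Finset.sum_add_distrib, Finset.sum_const, Finset.card_univ, smul_eq_mul]
      omega
    simp only [hs, Nat.cast_mul]
    rw [← Finset.sum_div, ← Finset.sum_mul, ← Nat.cast_sum, ← ht, Nat.factorial_succ,
      Nat.cast_mul, mul_div_mul_left]
    exact Nat.cast_ne_zero.2 (Nat.succ_ne_zero _)
  exact LinearMap.congr_fun key p

variable (I) in
/-- The integral `∫_I : P_I → K`. -/
def integral [CharZero K] [Nonempty I] : P K I →ₗ[K] K :=
  P.lift (polyInt K I) (polyInt_mul K)

variable (I) in
/-- The map `ξ_I : Φ_{I,m} → Hom_K(Ω^m_I, K)`, `ξ(i_J(α))(ω) = ∫_J ⟨α, res^I_J(ω)⟩`. -/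
def xi [CharZero K] (m : ℕ) : Phi K I m →ₗ[K] HatPhi K I m :=
  Phi.desc fun J =>
    ((thtPairing K J.1 m).compr₂ (integral K J.1)).compl₂
      (omPullback K (fun j : J.1 => (j : I)) m)

/-! ### The differential on `Φ` -/

theorem contractLeft_mem {M : Type*} [AddCommGroup M] [Module K M] (d : Module.Dual K M) (m : ℕ)
    {a : ExteriorAlgebra K M} (ha : a ∈ ⋀[K]^(m + 1) M) :
    CliffordAlgebra.contractLeft (Q := 0) d a ∈ ⋀[K]^m M := by
  induction m generalizing a with
  | zero =>
    rw [ExteriorAlgebra.exteriorPower, zero_add, pow_one] at ha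
    obtain ⟨x, rfl⟩ := ha
    rw [ExteriorAlgebra.exteriorPower, pow_zero]
    have h := CliffordAlgebra.contractLeft_ι (Q := (0 : QuadraticForm K M)) d x
    change CliffordAlgebra.contractLeft d (CliffordAlgebra.ι 0 x) ∈ _
    rw [h]
    exact Submodule.mem_one.2 ⟨d x, rfl⟩
  | succ m ih =>
    rw [ExteriorAlgebra.exteriorPower, pow_succ'] at ha
    induction ha using Submodule.mul_induction_on' with
    | mem_mul_mem x hx y hy =>
      obtain ⟨x, rfl⟩ := hx
      have h := CliffordAlgebra.contractLeft_ι_mul (Q := (0 : QuadraticForm K M)) (d := d) x y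
      change CliffordAlgebra.contractLeft d (CliffordAlgebra.ι 0 x * y) ∈ _
      rw [h]
      refine Submodule.sub_mem _ (Submodule.smul_mem _ _ hy) ?_
      rw [ExteriorAlgebra.exteriorPower, pow_succ']
      exact Submodule.mul_mem_mul (LinearMap.mem_range_self _ x) (ih hy)
    | add x hx y hy hx' hy' =>
      rw [map_add]
      exact Submodule.add_mem _ hx' hy'

/-- The interior product `u ⌟ a` for `u ∈ V` and `a ∈ Λ^{m+1}(V^∨)`. Up to sign this is the
antiderivation of `Λ(V^∨)` which extends evaluation at `u`; the sign is such that `u ⌟ a = -a(u)`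
for `a ∈ V^∨`. -/
def interiorMul (V : Type*) [AddCommGroup V] [Module K V] (m : ℕ) :
    V →ₗ[K] ⋀[K]^(m + 1) (Module.Dual K V) →ₗ[K] ⋀[K]^m (Module.Dual K V) :=
  LinearMap.mk₂ K
    (fun u a => ⟨-CliffordAlgebra.contractLeft (Q := 0) (Module.Dual.eval K V u) a.1, by
      exact Submodule.neg_mem _ (contractLeft_mem K _ m a.2)⟩)
    (fun u u' a => Subtype.ext (by simp; abel))
    (fun c u a => Subtype.ext (by simp))
    (fun u a a' => Subtype.ext (by simp; abel))
    (fun c u a => Subtype.ext (by simp))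

variable (I) in
/-- `δ'` on `Θ_{I,m+1}`: `f α₀ ↦ -(df ⌟ α₀)`. -/
def deltaOne (m : ℕ) : Tht K I (m + 1) →ₗ[K] Tht K I m :=
  -(TensorProduct.map LinearMap.id (TensorProduct.lift (interiorMul K (W K I) m)) ∘ₗ
    (TensorProduct.assoc K (P K I) (W K I) (⋀[K]^(m + 1) (WDual K I))).toLinearMap ∘ₗ
    TensorProduct.map (dFun K I) LinearMap.id)

section Push

variable {J : Type v} [Fintype J] (σ : I → J)

/-- The map `σ_* : Λ^m(W_I^∨) → Λ^m(W_J^∨)` dual to `σ^*`. -/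
def extPush (m : ℕ) : ⋀[K]^m (WDual K I) →ₗ[K] ⋀[K]^m (WDual K J) :=
  exteriorPower.map m (wPullback K σ).dualMap

end Push

open scoped Classical in
/-- For `j ∈ J ⊆ I`, the inclusion `J ∖ {j} → J`. -/
def eraseIncl {J : Finset I} (j : J) : (J.erase (j : I) : Finset I) → J :=
  fun k => ⟨k, Finset.mem_of_mem_erase k.2⟩

open scoped Classical in
/-- The component of `δ''` on `Θ_{J,m+1}` with values in `Θ_{J ∖ {j},m}`:
`f α₀ ↦ -res(f) (dt_j ⌟ α₀)`. Here `dt_j ⌟ α₀` lies in the image of the injective map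
`Λ^m(W_{J ∖ {j}}^∨) → Λ^m(W_J^∨)` dual to restriction, and is transported along the inverse of
this map. -/
def deltaTwo {J : Finset I} (j : J) (m : ℕ) :
    Tht K J (m + 1) →ₗ[K] Tht K (J.erase (j : I) : Finset I) m :=
  -TensorProduct.map (pPullback K (eraseIncl j)).toLinearMap
    ((extPush K (eraseIncl j) m).leftInverse ∘ₗ interiorMul K (W K J) m (dt K j))

open scoped Classical in
variable (I) in
/-- The differential `δ = δ' + δ'' : Φ_{I,m+1} → Φ_{I,m}`. The terms of `δ''` with
`J ∖ {j}` empty are zero. -/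
def delta (m : ℕ) : Phi K I (m + 1) →ₗ[K] Phi K I m :=
  Phi.desc fun J =>
    incl K J m ∘ₗ deltaOne K J.1 m +
      ∑ j : J.1, if h : (J.1.erase (j : I)).Nonempty then
        incl K ⟨J.1.erase (j : I), h⟩ m ∘ₗ deltaTwo K j m
      else 0

/-! ### Covariant functoriality -/

section Push

variable {J : Type v} [Fintype J] (σ : I → J)

open scoped Classical in
/-- The exponent `σ_*(ν + 1) - 1`, where `(σ_* μ)(j) = ∑_{σ i = j} μ i`. It is only used for
surjective `σ`, where `σ_*(ν + 1) ≥ 1`. -/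
def pushExp (ν : I →₀ ℕ) : J →₀ ℕ :=
  Finsupp.equivFunOnFinite.symm fun j => (∑ i : I with σ i = j, (ν i + 1)) - 1

/-- The linear map `K[t_i | i ∈ I] → K[t_j | j ∈ J]`, `t^ν / ν! ↦ t^μ / μ!` with
`μ = σ_*(ν + 1) - 1`. -/
def polyPush : MvPolynomial I K →ₗ[K] MvPolynomial J K :=
  (basisMonomials I K).constr K fun ν : I →₀ ℕ =>
    monomial (pushExp σ ν)
      (((∏ i : I, (ν i)! : ℕ) : K) / ((∏ j : J, (pushExp σ ν j)! : ℕ) : K))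

theorem polyPush_monomial (ν : I →₀ ℕ) :
    polyPush K σ (monomial ν 1) = monomial (pushExp σ ν)
      (((∏ i : I, (ν i)! : ℕ) : K) / ((∏ j : J, (pushExp σ ν j)! : ℕ) : K)) := by
  have := (basisMonomials I K).constr_basis K (fun ν : I →₀ ℕ => monomial (pushExp σ ν)
    (((∏ i : I, (ν i)! : ℕ) : K) / ((∏ j : J, (pushExp σ ν j)! : ℕ) : K))) ν
  rwa [coe_basisMonomials] at this

open scoped Classical in
variable {σ} in
theorem pushExp_add_one (hσ : Function.Surjective σ) (ν : I →₀ ℕ) (j : J) :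
    pushExp σ ν j + 1 = ∑ i : I with σ i = j, (ν i + 1) := by
  obtain ⟨i, hi⟩ := hσ j
  have h : ν i + 1 ≤ ∑ i : I with σ i = j, (ν i + 1) :=
    Finset.single_le_sum (f := fun i => ν i + 1) (fun _ _ => Nat.zero_le _)
      (Finset.mem_filter.2 ⟨Finset.mem_univ i, hi⟩)
  change (∑ i : I with σ i = j, (ν i + 1)) - 1 + 1 = _
  omega

variable {σ} in
theorem pushExp_add_single (hσ : Function.Surjective σ) (ν : I →₀ ℕ) (i : I) :
    pushExp σ (Finsupp.single i 1 + ν) = Finsupp.single (σ i) 1 + pushExp σ ν := by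
  classical
  ext j
  have h1 := pushExp_add_one hσ (Finsupp.single i 1 + ν) j
  have h2 := pushExp_add_one hσ ν j
  have h3 : ∑ k : I with σ k = j, (Finsupp.single i 1 : I →₀ ℕ) k =
      (Finsupp.single (σ i) 1 : J →₀ ℕ) j := by
    simp [Finsupp.single_apply, Finset.sum_ite_eq]
  simp only [Finsupp.add_apply, add_assoc] at h1 ⊢
  rw [Finset.sum_add_distrib, h3, ← h2] at h1
  omega

variable {σ} in
theorem polyPush_mul [CharZero K] (hσ : Function.Surjective σ) (p : MvPolynomial I K) :
    polyPush K σ ((1 - ∑ i : I, X i) * p) = (1 - ∑ j : J, X j) * polyPush K σ p := by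
  classical
  have key : polyPush K σ ∘ₗ LinearMap.mulLeft K (1 - ∑ i : I, X i) =
      LinearMap.mulLeft K (1 - ∑ j : J, X j) ∘ₗ polyPush K σ := by
    refine (basisMonomials I K).ext fun ν => ?_
    rw [coe_basisMonomials, LinearMap.comp_apply, LinearMap.mulLeft_apply,
      one_sub_sum_X_mul_monomial, map_sub, map_sum, LinearMap.comp_apply,
      LinearMap.mulLeft_apply, sub_mul, one_mul, Finset.sum_mul]
    simp only [polyPush_monomial, prod_factorial_add_single, pushExp_add_single hσ, X,
      monomial_mul, one_mul]
    congr 1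
    rw [← Finset.sum_fiberwise Finset.univ σ]
    refine Finset.sum_congr rfl fun j _ => ?_
    have h : ∀ i ∈ Finset.univ.filter (fun i => σ i = j),
        (monomial (Finsupp.single (σ i) 1 + pushExp σ ν))
          ((((ν i + 1) * ∏ k : I, (ν k)! : ℕ) : K) /
            (((pushExp σ ν (σ i) + 1) * ∏ k : J, (pushExp σ ν k)! : ℕ) : K)) =
        (monomial (Finsupp.single j 1 + pushExp σ ν))
          (((ν i + 1 : ℕ) : K) * (((∏ k : I, (ν k)! : ℕ) : K) /
            (((pushExp σ ν j + 1) * ∏ k : J, (pushExp σ ν k)! : ℕ) : K))) := by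
      intro i hi
      rw [(Finset.mem_filter.1 hi).2, Nat.cast_mul (ν i + 1), mul_div_assoc]
    rw [Finset.sum_congr rfl h, ← map_sum, ← Finset.sum_mul, ← Nat.cast_sum,
      ← pushExp_add_one hσ, Nat.cast_mul (pushExp σ ν j + 1), ← mul_div_assoc,
      mul_div_mul_left]
    exact Nat.cast_ne_zero.2 (Nat.succ_ne_zero _)
  exact LinearMap.congr_fun key p

variable {σ} in
/-- The map `σ_* : P_I → P_J` for surjective `σ : I → J`. -/
def pPush [CharZero K] (hσ : Function.Surjective σ) : P K I →ₗ[K] P K J :=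
  P.lift ((P.mk K J).toLinearMap ∘ₗ polyPush K σ) (by
    intro p
    rw [LinearMap.comp_apply, polyPush_mul K hσ]
    exact P.mk_relation_mul K _)

variable {σ} in
/-- The map `σ_* : Θ_{I,m} → Θ_{J,m}` for surjective `σ : I → J`. -/
def thtPush [CharZero K] (hσ : Function.Surjective σ) (m : ℕ) : Tht K I m →ₗ[K] Tht K J m :=
  TensorProduct.map (pPush K hσ) (extPush K σ m)

open scoped Classical in
/-- The image `σ(A)` of a nonempty subset `A` of `I`. -/
def imageNE (A : NESub I) : NESub J :=
  ⟨A.1.image σ, A.2.image σ⟩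

open scoped Classical in
/-- The surjection `A → σ(A)` given by `σ`. -/
def toImage (A : NESub I) : A.1 → (imageNE σ A).1 :=
  fun a => ⟨σ a, Finset.mem_image_of_mem σ a.2⟩

set_option linter.unusedSectionVars false in
theorem toImage_surjective (A : NESub I) : Function.Surjective (toImage σ A) := by
  classical
  rintro ⟨b, hb⟩
  obtain ⟨a, ha, rfl⟩ := Finset.mem_image.1 hb
  exact ⟨⟨a, ha⟩, rfl⟩

/-- The map `σ_* : Φ_{I,m} → Φ_{J,m}`, `i_A(α) ↦ i_{σ(A)}(σ_*(α))`, for an arbitrary map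
`σ : I → J`. -/
def push [CharZero K] (m : ℕ) : Phi K I m →ₗ[K] Phi K J m :=
  Phi.desc fun A => incl K (imageNE σ A) m ∘ₗ thtPush K (toImage_surjective σ A) m

end Push

/-! ### The chain complexes `Φ_{I,*}` -/

open CategoryTheory

variable (I) in
/-- The complex `(Φ_{I,*}, δ)`, provided that `δ² = 0`. -/
def PhiComplex (hd : ∀ m, delta K I m ∘ₗ delta K I (m + 1) = 0) :
    ChainComplex (ModuleCat.{max u v} K) ℕ :=
  ChainComplex.of (fun m => ModuleCat.of K (Phi K I m))
    (fun m => ModuleCat.ofHom (delta K I m))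
    (fun m => by rw [← ModuleCat.ofHom_comp, hd]; rfl)

variable (I) in
set_option linter.unusedSectionVars false in
theorem PhiComplex_d (hd : ∀ m, delta K I m ∘ₗ delta K I (m + 1) = 0) (m : ℕ) :
    (PhiComplex K I hd).d (m + 1) m = ModuleCat.ofHom (delta K I m) :=
  ChainComplex.of_d (fun m => ModuleCat.of K (Phi K I m)) (fun m => ModuleCat.ofHom (delta K I m)) m

/-- The chain map `σ_* : Φ_{I,*} → Φ_{J,*}`, provided that `σ_*` commutes with `δ`. -/
def PhiMap [CharZero K] {J : Type v} [Fintype J] (σ : I → J)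
    (hI : ∀ m, delta K I m ∘ₗ delta K I (m + 1) = 0)
    (hJ : ∀ m, delta K J m ∘ₗ delta K J (m + 1) = 0)
    (hσ : ∀ m, delta K J m ∘ₗ push K σ (m + 1) = push K σ m ∘ₗ delta K I m) :
    PhiComplex K I hI ⟶ PhiComplex K J hJ :=
  ChainComplex.ofHom (fun m => ModuleCat.ofHom (push K σ m))
    (fun m => by
      have h1 := PhiComplex_d K I hI m
      have h2 := PhiComplex_d K J hJ m
      refine (congrArg (fun g => ModuleCat.ofHom (push K σ (m + 1)) ≫ g) h2).trans
        (Eq.trans ?_ (congrArg (fun g => g ≫ ModuleCat.ofHom (push K σ m)) h1).symm)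
      exact congrArg ModuleCat.ofHom (hσ m))

/-- The element `i_{{j}}(1)` of `Φ_{I,0}`. -/
def vertex (j : I) : Phi K I 0 :=
  incl K ⟨{j}, Finset.singleton_nonempty j⟩ 0
    (1 ⊗ₜ[K] exteriorPower.ιMulti K 0 Fin.elim0)

end DeRhamChains

end

/-! Everything is transported through `xi` from the dual of the de Rham complex, where the
identities are formal. An element of `Tht` on a face is a polynomial multivector field. Integrating
it against forms gives a functional (`current`), and `xi` adds up such functionals over the faces.

Injectivity (`xi_injective`): the function `∏ a ∈ A, X a` vanishes on every face that does not
contain `A`. Testing against its multiples and descending from large faces to small ones isolates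
the component at `A`. What remains is the nondegeneracy of `(f, g) ↦ ∫ t^κ₀ f g` on one simplex
(`integral_nondegenerate`), where the integral is the Dirichlet formula in factorials.

Differential (`xi_comp_delta`): wedging with `w` is adjoint, up to sign, to contracting with `w`.
Integration by parts on the simplex (`integral_coeffMap_dFun`) therefore writes the dual of `d` as
an interior term plus one term for each facet, and these are `deltaOne` and `deltaTwo`.

Naturality (`xi_push`): `pPush` is adjoint to `pPullback` under the integral, by the projection
formula and the invariance of the integral. Since `xi` is injective, `δ² = 0`, the compatibility of
`δ` with `push` and functoriality all follow from the corresponding facts about forms.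

Quasi-isomorphisms: integration along the fibres of `collapse y` is a homotopy between restrictions
to two facets of a simplex with one more vertex (`fibreIntegral_deRham`). Precomposing with the
pullback along `collapse x` gives a homotopy on forms between the identity and the pullback by the
map that moves `y` to `x`. Its dual preserves the image of `xi` (`dualMap_mergeHomotopy_mem_range`),
so it lifts to `Phi`. Moving the vertices one by one shows that constant self-maps act homotopically
to the identity. For `σ : I → J` with both sets nonempty, any constant map `J → I` is then a
homotopy inverse. -/

noncomputable section

namespace DeRhamChains

open scoped TensorProduct Nat
open MvPolynomial

/-! ### Exterior powers: wedge, contraction and rank-one perturbations -/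

section Exterior

variable (K : Type*) [Field K] {V U : Type*} [AddCommGroup V] [Module K V] [AddCommGroup U]
  [Module K U]

theorem coe_exteriorPower_map (m : ℕ) (f : V →ₗ[K] U) (x : ⋀[K]^m V) :
    (exteriorPower.map m f x : ExteriorAlgebra K U) = ExteriorAlgebra.map f x := by
  have h : (⋀[K]^m U).subtype ∘ₗ exteriorPower.map m f =
      (ExteriorAlgebra.map f).toLinearMap ∘ₗ (⋀[K]^m V).subtype := by
    refine exteriorPower.linearMap_ext ?_
    ext w
    simp [ExteriorAlgebra.map_apply_ιMulti, Function.comp_def]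
  exact LinearMap.congr_fun h x

theorem wedge_ιMulti (m : ℕ) (v : V) (w : Fin m → V) :
    wedge K V m v (exteriorPower.ιMulti K m w) =
      exteriorPower.ιMulti K (m + 1) (Fin.cons v w) := by
  refine Subtype.ext ?_
  simp [wedge, ExteriorAlgebra.ιMulti_succ_apply, Matrix.vecTail, Function.comp_def]

/-- Contraction with a linear form, from `Λ^{m+1}(V)` to `Λ^m(V)`. -/
def contract (m : ℕ) (d : Module.Dual K V) : ⋀[K]^(m + 1) V →ₗ[K] ⋀[K]^m V :=
  (CliffordAlgebra.contractLeft (Q := (0 : QuadraticForm K V)) d).restrict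
    fun _ hx => contractLeft_mem K d m hx

variable {K}

theorem coe_contract (m : ℕ) (d : Module.Dual K V) (x : ⋀[K]^(m + 1) V) :
    (contract K m d x : ExteriorAlgebra K V) =
      CliffordAlgebra.contractLeft (Q := (0 : QuadraticForm K V)) d x.1 :=
  rfl

theorem interiorMul_eq (m : ℕ) (v : V) (x : ⋀[K]^(m + 1) (Module.Dual K V)) :
    interiorMul K V m v x = -contract K m (Module.Dual.eval K V v) x :=
  rfl

theorem contractLeft_ι_mul (d : Module.Dual K V) (x : V) (y : ExteriorAlgebra K V) :
    CliffordAlgebra.contractLeft (Q := (0 : QuadraticForm K V)) d (ExteriorAlgebra.ι K x * y) =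
      d x • y - ExteriorAlgebra.ι K x *
        CliffordAlgebra.contractLeft (Q := (0 : QuadraticForm K V)) d y :=
  CliffordAlgebra.contractLeft_ι_mul (Q := (0 : QuadraticForm K V)) d x y

theorem contract_zero_wedge (d : Module.Dual K V) (v : V) (x : ⋀[K]^0 V) :
    contract K 0 d (wedge K V 0 v x) = d v • x := by
  refine Subtype.ext ?_
  rw [coe_contract]
  change CliffordAlgebra.contractLeft (Q := (0 : QuadraticForm K V)) d
    (ExteriorAlgebra.ι K v * x.1) = d v • x.1
  have hx : x.1 ∈ (1 : Submodule K (ExteriorAlgebra K V)) := by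
    simpa [ExteriorAlgebra.exteriorPower] using x.2
  obtain ⟨r, hr⟩ := Submodule.mem_one.1 hx
  rw [contractLeft_ι_mul, ← hr]
  have := CliffordAlgebra.contractLeft_algebraMap (Q := (0 : QuadraticForm K V)) d r
  rw [show CliffordAlgebra.contractLeft (Q := (0 : QuadraticForm K V)) d
    (algebraMap K (ExteriorAlgebra K V) r) = 0 from this, mul_zero, sub_zero]

theorem contract_wedge (m : ℕ) (d : Module.Dual K V) (v : V) (x : ⋀[K]^(m + 1) V) :
    contract K (m + 1) d (wedge K V (m + 1) v x) = d v • x - wedge K V m v (contract K m d x) :=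
  Subtype.ext (contractLeft_ι_mul d v x.1)

theorem contractLeft_ιMulti (m : ℕ) (d : Module.Dual K V) (f : Fin (m + 1) → V) :
    CliffordAlgebra.contractLeft (Q := (0 : QuadraticForm K V)) d
        (ExteriorAlgebra.ιMulti K (m + 1) f) =
      ∑ i : Fin (m + 1), ((-1) ^ (i : ℕ) * d (f i)) •
        ExteriorAlgebra.ιMulti K m fun k => f (i.succAbove k) := by
  induction m with
  | zero =>
    rw [ExteriorAlgebra.ιMulti_succ_apply, contractLeft_ι_mul, ExteriorAlgebra.ιMulti_zero_apply]
    have := CliffordAlgebra.contractLeft_one (Q := (0 : QuadraticForm K V)) d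
    rw [show CliffordAlgebra.contractLeft (Q := (0 : QuadraticForm K V)) d
      (1 : ExteriorAlgebra K V) = 0 from this]
    simp
  | succ m ih =>
    rw [ExteriorAlgebra.ιMulti_succ_apply, contractLeft_ι_mul, ih, Finset.mul_sum,
      Fin.sum_univ_succ (n := m + 1), sub_eq_add_neg, ← Finset.sum_neg_distrib]
    congr 1
    · simp [Matrix.vecTail, Function.comp_def]
    · refine Finset.sum_congr rfl fun i _ => ?_
      rw [ExteriorAlgebra.ιMulti_succ_apply, mul_smul_comm, ← neg_smul]
      simp only [Matrix.vecTail, Function.comp_def, Fin.val_succ, pow_succ, Fin.succ_succAbove_zero,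
        Fin.succ_succAbove_succ]
      congr 1
      ring

theorem contract_ιMulti (m : ℕ) (d : Module.Dual K V) (f : Fin (m + 1) → V) :
    contract K m d (exteriorPower.ιMulti K (m + 1) f) =
      ∑ i : Fin (m + 1), ((-1) ^ (i : ℕ) * d (f i)) •
        exteriorPower.ιMulti K m fun k => f (i.succAbove k) := by
  refine Subtype.ext ?_
  rw [coe_contract, exteriorPower.ιMulti_apply_coe, contractLeft_ιMulti]
  simp

/-- On decomposable elements this is the Laplace expansion of the determinant along the row of the
new vector `v`. It is the algebraic half of the identity between `δ` and the dual of `d`. -/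
theorem pairingDual_wedge (m : ℕ) (v : V) (α : ⋀[K]^(m + 1) (Module.Dual K V)) (ω : ⋀[K]^m V) :
    exteriorPower.pairingDual K V (m + 1) α (wedge K V m v ω) =
      exteriorPower.pairingDual K V m (contract K m (Module.Dual.eval K V v) α) ω := by
  have h : (exteriorPower.pairingDual K V (m + 1)).compl₂ (wedge K V m v) =
      exteriorPower.pairingDual K V m ∘ₗ contract K m (Module.Dual.eval K V v) := by
    refine exteriorPower.linearMap_ext ?_
    ext f : 1
    refine exteriorPower.linearMap_ext ?_
    ext w
    simp only [LinearMap.compAlternatingMap_apply, LinearMap.compl₂_apply, LinearMap.comp_apply,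
      wedge_ιMulti, contract_ιMulti, map_sum, map_smul, LinearMap.sum_apply, LinearMap.smul_apply,
      exteriorPower.pairingDual_ιMulti_ιMulti]
    rw [Matrix.det_succ_row_zero]
    refine Finset.sum_congr rfl fun i _ => ?_
    simp only [Matrix.of_apply, Fin.cons_zero, Module.Dual.eval_apply, smul_eq_mul]
    congr 2
  exact LinearMap.congr_fun₂ h α ω

theorem pairingDual_map (m : ℕ) (f : V →ₗ[K] U) (α : ⋀[K]^m (Module.Dual K U)) (ω : ⋀[K]^m V) :
    exteriorPower.pairingDual K V m (exteriorPower.map m f.dualMap α) ω =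
      exteriorPower.pairingDual K U m α (exteriorPower.map m f ω) := by
  have h : exteriorPower.pairingDual K V m ∘ₗ exteriorPower.map m f.dualMap =
      (exteriorPower.pairingDual K U m).compl₂ (exteriorPower.map m f) := by
    refine exteriorPower.linearMap_ext ?_
    ext g : 1
    refine exteriorPower.linearMap_ext ?_
    ext w
    simp [exteriorPower.map_apply_ιMulti, exteriorPower.pairingDual_ιMulti_ιMulti]
  exact LinearMap.congr_fun₂ h α ω

/-- Since `u ∧ u = 0`, expanding a product of terms `a x + d x • u` leaves only the summands with at
most one factor `u`. Those with exactly one are collected by the contraction with `d`. -/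
theorem exteriorAlgebra_map_add_smul {a b : V →ₗ[K] U} {d : Module.Dual K V} {u : U}
    (h : ∀ x, b x = a x + d x • u) (x : ExteriorAlgebra K V) :
    ExteriorAlgebra.map b x = ExteriorAlgebra.map a x + ExteriorAlgebra.ι K u *
      ExteriorAlgebra.map a
        (CliffordAlgebra.contractLeft (Q := (0 : QuadraticForm K V)) d x) := by
  induction x using CliffordAlgebra.left_induction with
  | algebraMap r =>
    rw [CliffordAlgebra.contractLeft_algebraMap]
    have h1 := (ExteriorAlgebra.map a).commutes r
    have h2 := (ExteriorAlgebra.map b).commutes r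
    erw [h1, h2, map_zero, mul_zero, add_zero]
  | add x y hx hy => 
    simp only [map_add, mul_add, hx, hy]
    abel
  | ι_mul x w hx =>
    have h1 := contractLeft_ι_mul d w x
    change ExteriorAlgebra.map b (ExteriorAlgebra.ι K w * x) =
      ExteriorAlgebra.map a (ExteriorAlgebra.ι K w * x) + ExteriorAlgebra.ι K u *
      ExteriorAlgebra.map a (CliffordAlgebra.contractLeft (Q := (0 : QuadraticForm K V)) d
        (ExteriorAlgebra.ι K w * x))
    rw [h1]
    simp only [map_mul, map_sub, map_smul, ExteriorAlgebra.map_apply_ι, hx, h, map_add]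
    set y := ExteriorAlgebra.map a
        (CliffordAlgebra.contractLeft (Q := (0 : QuadraticForm K V)) d x)
    set z := ExteriorAlgebra.map a x
    have e1 := ExteriorAlgebra.ι_sq_zero (R := K) u
    have e2 : ExteriorAlgebra.ι K u * ExteriorAlgebra.ι K (a w) =
      - (ExteriorAlgebra.ι K (a w) * ExteriorAlgebra.ι K u) :=
      eq_neg_of_add_eq_zero_left (ExteriorAlgebra.ι_add_mul_swap u (a w))
    simp only [add_mul, mul_add, mul_sub, ← mul_assoc, smul_mul_assoc, mul_smul_comm, e1, e2,
      zero_mul, smul_zero, neg_mul]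
    abel

theorem exteriorPower_map_add_smul {a b : V →ₗ[K] U} {d : Module.Dual K V} {u : U}
    (h : ∀ x, b x = a x + d x • u) (m : ℕ) (x : ⋀[K]^(m + 1) V) :
    exteriorPower.map (m + 1) b x = exteriorPower.map (m + 1) a x +
      wedge K U m u (exteriorPower.map m a (contract K m d x)) := by
  refine Subtype.ext ?_
  rw [coe_exteriorPower_map, exteriorAlgebra_map_add_smul h]
  change _ = (exteriorPower.map (m + 1) a x : ExteriorAlgebra K U) + ExteriorAlgebra.ι K u *
    (exteriorPower.map m a (contract K m d x) : ExteriorAlgebra K U)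
  rw [coe_exteriorPower_map, coe_exteriorPower_map, coe_contract]

theorem exteriorPower_map_wedge (f : V →ₗ[K] U) (m : ℕ) (v : V) (x : ⋀[K]^m V) :
    exteriorPower.map (m + 1) f (wedge K V m v x) =
      wedge K U m (f v) (exteriorPower.map m f x) := by
  refine Subtype.ext ?_
  rw [coe_exteriorPower_map]
  change ExteriorAlgebra.map f (ExteriorAlgebra.ι K v * x.1) = ExteriorAlgebra.ι K (f v) *
    (exteriorPower.map m f x : ExteriorAlgebra K U)
  rw [map_mul, ExteriorAlgebra.map_apply_ι, coe_exteriorPower_map]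

theorem wedge_wedge_swap (m : ℕ) (v w : V) (x : ⋀[K]^m V) :
    wedge K V (m + 1) v (wedge K V m w x) = -wedge K V (m + 1) w (wedge K V m v x) := by
  refine Subtype.ext ?_
  change ExteriorAlgebra.ι K v * (ExteriorAlgebra.ι K w * x.1) =
    -(ExteriorAlgebra.ι K w * (ExteriorAlgebra.ι K v * x.1))
  rw [← mul_assoc, ← mul_assoc, ← neg_mul,
    eq_neg_of_add_eq_zero_left (ExteriorAlgebra.ι_add_mul_swap v w)]

/-- A contraction `contract d x` lies in the exterior power of any subspace containing the kernel
of `d`. -/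
theorem contract_mem_range_map (m : ℕ) (d : Module.Dual K V) {f : U →ₗ[K] V}
    (hf : LinearMap.ker d ≤ LinearMap.range f) (x : ⋀[K]^(m + 1) V) :
    contract K m d x ∈ LinearMap.range (exteriorPower.map m f) := by
  by_cases hd : d = 0
  · subst hd
    convert Submodule.zero_mem _
    refine Subtype.ext ?_
    rw [coe_contract, map_zero]
    rfl
  obtain ⟨a, ha⟩ : ∃ a, d a = 1 := by
    obtain ⟨b, hb⟩ := DFunLike.ne_iff.1 hd
    exact ⟨(d b)⁻¹ • b, by simpa using inv_mul_cancel₀ hb⟩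
  -- `y - d y • a` is the projection to `ker d` along `a`. Lifting it through `f` on a basis gives
  -- `s` with `f ∘ s` a rank-one perturbation of the identity.
  have hp (y : V) : ∃ z, f z = y - d y • a :=
    hf (by simp [ha])
  let b := Module.Basis.ofVectorSpace K V
  choose g hg using hp
  let s : V →ₗ[K] U := b.constr K fun i => g (b i)
  have hs (y : V) : (f ∘ₗ s) y = LinearMap.id (R := K) y + d y • (-a) := by
    have : f ∘ₗ s = LinearMap.id + d.smulRight (-a) := by
      refine b.ext fun i => ?_
      simp [s, hg, sub_eq_add_neg]
    rw [this]
    rfl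
  refine ⟨exteriorPower.map m s (contract K m d x), Subtype.ext ?_⟩
  -- The correction term of the perturbation contracts with `d` a second time, so it vanishes and `f
  -- ∘ s` fixes `contract K m d x`.
  rw [← LinearMap.comp_apply, ← exteriorPower.map_comp, coe_exteriorPower_map,
    exteriorAlgebra_map_add_smul hs, coe_contract,
    CliffordAlgebra.contractLeft_contractLeft]
  simp only [map_zero, ExteriorAlgebra.map_id]
  rw [mul_zero, add_zero]
  rfl

end Exterior

/-! ### Perfectness of the pairing of exterior powers -/

section Perfect

open Module

variable {K : Type*} [Field K] {V : Type*} [AddCommGroup V] [Module K V] {ι : Type*} [LinearOrder ι]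
  [Fintype ι]

theorem pairingDual_basis (b : Basis ι K V) (m : ℕ) (s : Set.powersetCard ι m) :
    exteriorPower.pairingDual K V m (b.dualBasis.exteriorPower m s) =
      (b.exteriorPower m).coord s := by
  rw [exteriorPower.basis_coord, exteriorPower.basis_apply, exteriorPower.ιMultiDual,
    Basis.coe_dualBasis]

theorem pairingDual_surjective [FiniteDimensional K V] (m : ℕ) :
    Function.Surjective (exteriorPower.pairingDual K V m) := by
  intro l
  let b := Module.finBasis K V
  refine ⟨∑ s, l (b.exteriorPower m s) • b.dualBasis.exteriorPower m s, ?_⟩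
  rw [map_sum]
  refine (b.exteriorPower m).ext fun t => ?_
  simp only [map_smul, pairingDual_basis, LinearMap.sum_apply, LinearMap.smul_apply,
    Basis.coord_apply, Basis.repr_self, smul_eq_mul]
  rw [Finset.sum_eq_single t]
  · simp
  · intro s _ hs
    rw [Finsupp.single_eq_of_ne hs, mul_zero]
  · simp

end Perfect

/-! ### Divided monomials on the simplex -/

section Polynomials

set_option linter.unusedSectionVars false

variable (K : Type u) [Field K] {I : Type v} [Fintype I]

theorem P.mk_surjective : Function.Surjective (P.mk K I) :=
  Ideal.Quotient.mkₐ_surjective K _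

/-- The divided monomial `t^ν / ν!`. -/
def divMonomial (ν : I →₀ ℕ) : MvPolynomial I K :=
  monomial ν (((∏ i : I, (ν i)! : ℕ) : K)⁻¹)

variable {K}

theorem prod_factorial_ne_zero [CharZero K] (ν : I →₀ ℕ) : ((∏ i : I, (ν i)! : ℕ) : K) ≠ 0 :=
  Nat.cast_ne_zero.2 (Finset.prod_ne_zero_iff.2 fun _ _ => Nat.factorial_ne_zero _)

theorem divMonomial_eq_smul (ν : I →₀ ℕ) :
    divMonomial K ν = ((∏ i : I, (ν i)! : ℕ) : K)⁻¹ • monomial ν 1 := by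
  rw [divMonomial, smul_monomial, smul_eq_mul, mul_one]

theorem monomial_eq_smul_divMonomial [CharZero K] (ν : I →₀ ℕ) :
    monomial ν (1 : K) = ((∏ i : I, (ν i)! : ℕ) : K) • divMonomial K ν := by
  rw [divMonomial_eq_smul, smul_smul, mul_inv_cancel₀ (prod_factorial_ne_zero ν), one_smul]

/-- Divided monomials are the convenient basis in characteristic zero: `∂_i` lowers an exponent
without a coefficient, `polyPush` takes divided monomials to divided monomials, and the integral
sees only the total degree. -/
theorem linearMap_ext_divMonomial [CharZero K] {M : Type*} [AddCommMonoid M] [Module K M]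
    {f g : MvPolynomial I K →ₗ[K] M} (h : ∀ ν, f (divMonomial K ν) = g (divMonomial K ν)) :
    f = g := by
  refine (basisMonomials I K).ext fun ν => ?_
  rw [coe_basisMonomials]
  beta_reduce
  rw [monomial_eq_smul_divMonomial, map_smul, map_smul, h]

theorem X_mul_divMonomial [CharZero K] (i : I) (ν : I →₀ ℕ) :
    X i * divMonomial K ν = ((ν i + 1 : ℕ) : K) • divMonomial K (Finsupp.single i 1 + ν) := by
  rw [divMonomial, divMonomial, X, monomial_mul, one_mul, smul_monomial, smul_eq_mul,
    prod_factorial_add_single, Nat.cast_mul, mul_inv, mul_inv_cancel_left₀]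
  exact Nat.cast_ne_zero.2 (Nat.succ_ne_zero _)

theorem pderiv_divMonomial_add [CharZero K] (i : I) (ν : I →₀ ℕ) :
    pderiv i (divMonomial K (Finsupp.single i 1 + ν)) = divMonomial K ν := by
  rw [divMonomial, pderiv_monomial, divMonomial, prod_factorial_add_single, add_tsub_cancel_left,
    Finsupp.add_apply, Finsupp.single_eq_same, add_comm 1, Nat.cast_mul, mul_inv, mul_comm,
    mul_inv_cancel_left₀]
  exact Nat.cast_ne_zero.2 (Nat.succ_ne_zero _)

theorem pderiv_divMonomial_of_eq_zero {i : I} {ν : I →₀ ℕ} (h : ν i = 0) :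
    pderiv i (divMonomial K ν) = 0 := by
  rw [divMonomial, pderiv_monomial, h, Nat.cast_zero, mul_zero, map_zero]

theorem exists_eq_single_add {i : I} {ν : I →₀ ℕ} (h : ν i ≠ 0) :
    ∃ κ, ν = Finsupp.single i 1 + κ :=
  ⟨ν - Finsupp.single i 1, by
    ext k
    by_cases hk : k = i
    · subst hk
      simp
      omega
    · simp [Finsupp.single_eq_of_ne hk]⟩

theorem polyInt_divMonomial [CharZero K] (ν : I →₀ ℕ) :
    polyInt K I (divMonomial K ν) = ((Fintype.card I - 1 + ∑ i : I, ν i)! : K)⁻¹ := by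
  rw [divMonomial_eq_smul, map_smul, polyInt_monomial, smul_eq_mul, div_eq_mul_inv,
    inv_mul_cancel_left₀ (prod_factorial_ne_zero ν)]

theorem integral_mk [CharZero K] [Nonempty I] (p : MvPolynomial I K) :
    integral K I (P.mk K I p) = polyInt K I p :=
  rfl

variable {J : Type v} [Fintype J]

theorem polyPush_divMonomial [CharZero K] (σ : I → J) (ν : I →₀ ℕ) :
    polyPush K σ (divMonomial K ν) = divMonomial K (pushExp σ ν) := by
  rw [divMonomial_eq_smul, map_smul, polyPush_monomial, smul_monomial, smul_eq_mul,
    div_eq_mul_inv, inv_mul_cancel_left₀ (prod_factorial_ne_zero ν), divMonomial]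

theorem monomial_one_eq_prod (ν : I →₀ ℕ) : monomial ν (1 : K) = ∏ i : I, X i ^ ν i := by
  rw [monomial_eq, map_one, one_mul, Finsupp.prod_fintype]
  intro i
  exact pow_zero _

theorem polyPullback_X_apply {σ : I → J} (hσ : Function.Injective σ) (i : I) :
    polyPullback K σ (X (σ i)) = X i := by
  classical
  rw [polyPullback, aeval_X]
  rw [Finset.sum_eq_single_of_mem i (by simp)]
  intro b hb hbi
  exact absurd (hσ (by simpa using hb)) hbi

theorem polyPullback_X_of_notMem {σ : I → J} {j : J} (hj : j ∉ Set.range σ) :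
    polyPullback K σ (X j) = 0 := by
  classical
  rw [polyPullback, aeval_X]
  refine Finset.sum_eq_zero fun b hb => ?_
  exact absurd ⟨b, by simpa using hb⟩ hj

theorem polyPullback_divMonomial {σ : I → J} (hσ : Function.Injective σ) {ν : J →₀ ℕ}
    (h : ∀ j ∉ Set.range σ, ν j = 0) :
    polyPullback K σ (divMonomial K ν) = divMonomial K (ν.comapDomain σ hσ.injOn) := by
  rw [divMonomial_eq_smul, divMonomial_eq_smul, map_smul, monomial_one_eq_prod,
    monomial_one_eq_prod, map_prod]
  congr 1
  · congr 2
    refine (Fintype.prod_of_injective σ hσ _ _ ?_ ?_).symm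
    · intro j hj
      rw [h j hj, Nat.factorial_zero]
    · intro i
      rfl
  · refine (Fintype.prod_of_injective σ hσ _ _ ?_ ?_).symm
    · intro j hj
      rw [h j hj, pow_zero, map_one]
    · intro i
      rw [map_pow, polyPullback_X_apply hσ]
      rfl

theorem polyPullback_divMonomial_of_ne_zero {σ : I → J} {ν : J →₀ ℕ} {j : J}
    (hj : j ∉ Set.range σ) (h : ν j ≠ 0) : polyPullback K σ (divMonomial K ν) = 0 := by
  have h0 : polyPullback K σ (X j ^ ν j) = 0 := by
    rw [map_pow, polyPullback_X_of_notMem hj, zero_pow h]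
  rw [divMonomial_eq_smul, map_smul, monomial_one_eq_prod, map_prod]
  exact (congrArg _ (Finset.prod_eq_zero (Finset.mem_univ j) h0)).trans (smul_zero _)

theorem pPullback_mk (σ : I → J) (p : MvPolynomial J K) :
    pPullback K σ (P.mk K J p) = P.mk K I (polyPullback K σ p) :=
  rfl

theorem pPush_mk [CharZero K] {σ : I → J} (hσ : Function.Surjective σ) (p : MvPolynomial I K) :
    pPush K hσ (P.mk K I p) = P.mk K J (polyPush K σ p) :=
  rfl

/-! ### Differentials of functions -/

theorem dPoly_apply (p : MvPolynomial I K) :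
    dPoly K I p = ∑ i : I, P.mk K I (pderiv i p) ⊗ₜ[K] dt K i := by
  induction p using MvPolynomial.induction_on with
  | C a =>
    simp only [pderiv_C, map_zero, TensorProduct.zero_tmul, Finset.sum_const_zero]
    exact (dPoly K I).map_algebraMap a
  | add p q hp hq =>
    simp only [map_add, TensorProduct.add_tmul, Finset.sum_add_distrib, hp, hq]
  | mul_X p j hp =>
    have hX : dPoly K I (X j) = 1 ⊗ₜ[K] dt K j := mkDerivation_X _ _ _
    have hs (q : MvPolynomial I K) (f : P K I) (w : W K I) :
        q • (f ⊗ₜ[K] w) = (P.mk K I q * f) ⊗ₜ[K] w := by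
      rw [TensorProduct.smul_tmul', Algebra.smul_def]
      rfl
    classical
    rw [Derivation.leibniz, hp, hX, hs, Finset.smul_sum]
    simp only [hs, Derivation.leibniz, pderiv_X, map_add, smul_eq_mul, map_mul,
      TensorProduct.add_tmul, Finset.sum_add_distrib, mul_one]
    congr 1
    rw [Finset.sum_eq_single j]
    · simp
    · intro i _ hij
      simp [hij.symm]
    · simp

theorem dFun_mk (p : MvPolynomial I K) :
    dFun K I (P.mk K I p) = ∑ i : I, P.mk K I (pderiv i p) ⊗ₜ[K] dt K i :=
  dPoly_apply p

theorem dt_eq [DecidableEq I] (i : I) :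
    dt K i = (Submodule.span K {(1 : I → K)}).mkQ (Pi.single i 1) := by
  unfold dt
  rw [Submodule.mkQ_apply]
  congr
  exact Subsingleton.elim _ _

theorem wPullback_mkQ (σ : I → J) (w : J → K) :
    wPullback K σ ((Submodule.span K {(1 : J → K)}).mkQ w) =
      (Submodule.span K {(1 : I → K)}).mkQ (w ∘ σ) :=
  rfl

theorem wPullback_dt (σ : I → J) (j : J) [DecidableEq J] :
    wPullback K σ (dt K j) = ∑ i : I with σ i = j, dt K i := by
  classical
  simp only [dt_eq]
  rw [wPullback_mkQ, ← map_sum]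
  congr 1
  ext i
  rw [Finset.sum_apply]
  simp [Pi.single_apply, Finset.sum_ite_eq]

theorem dFun_pPullback (σ : I → J) (f : P K J) :
    dFun K I (pPullback K σ f) =
      TensorProduct.map (pPullback K σ).toLinearMap (wPullback K σ) (dFun K J f) := by
  classical
  obtain ⟨p, rfl⟩ := P.mk_surjective K f
  rw [pPullback_mk]
  induction p using MvPolynomial.induction_on with
  | C a =>
    rw [show polyPullback K σ (C a) = C a from (polyPullback K σ).commutes a]
    simp only [dFun_mk, pderiv_C, map_zero, TensorProduct.zero_tmul, Finset.sum_const_zero,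
      map_zero]
  | add p q hp hq => simp only [map_add, hp, hq]
  | mul_X p j hp =>
    simp only [dFun_mk] at hp ⊢
    simp only [map_sum, TensorProduct.map_tmul, AlgHom.toLinearMap_apply, pPullback_mk] at hp ⊢
    simp only [map_mul, Derivation.leibniz, map_add, smul_eq_mul, TensorProduct.add_tmul,
      Finset.sum_add_distrib]
    have hm {A : Type v} [Fintype A] (f g : P K A) (w : W K A) :
        (f * g) ⊗ₜ[K] w = TensorProduct.map (LinearMap.mulLeft K f) LinearMap.id (g ⊗ₜ w) := rfl
    congr 1
    · simp only [hm, ← map_sum]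
      congr 1
      simp only [pderiv_X, polyPullback, aeval_X, map_sum]
      rw [Finset.sum_eq_single j]
      · simp only [Pi.single_eq_same, map_one, wPullback_dt, TensorProduct.tmul_sum,
          TensorProduct.sum_tmul]
        rw [Finset.sum_comm]
        refine Finset.sum_congr rfl fun i _ => ?_
        rw [Finset.sum_eq_single i]
        · simp
        · intro b _ hb
          simp [hb.symm]
        · simp
      · intro k _ hk
        simp [hk.symm]
      · simp
    · simp only [hm, ← map_sum, hp]

/-! ### The projection formula -/

/-- Multiplying `t^ν/ν!` by `t_i` produces the factor `ν i + 1`. Over the fibre of `j` these factors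
add up to `pushExp σ ν j + 1`, which is the factor produced by `t_j` on the other side. -/
theorem polyPush_mul_pullback_X [CharZero K] {σ : I → J} (hσ : Function.Surjective σ)
    (p : MvPolynomial I K) (j : J) :
    polyPush K σ (p * polyPullback K σ (X j)) = polyPush K σ p * X j := by
  classical
  have key : polyPush K σ ∘ₗ LinearMap.mulRight K (polyPullback K σ (X j)) =
      LinearMap.mulRight K (X j) ∘ₗ polyPush K σ := by
    refine linearMap_ext_divMonomial fun ν => ?_
    simp only [LinearMap.comp_apply, LinearMap.mulRight_apply, polyPush_divMonomial, polyPullback,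
      aeval_X, Finset.mul_sum, map_sum]
    rw [mul_comm _ (X j), X_mul_divMonomial, pushExp_add_one hσ, Nat.cast_sum, Finset.sum_smul]
    have (i : I) (hi : i ∈ Finset.univ.filter fun i => σ i = j) :
        polyPush K σ (divMonomial K ν * X i) = ((ν i + 1 : ℕ) : K) •
          divMonomial K (Finsupp.single j 1 + pushExp σ ν) := by
      rw [mul_comm, X_mul_divMonomial, map_smul, polyPush_divMonomial, pushExp_add_single hσ,
        (Finset.mem_filter.1 hi).2]
    rw [← Finset.sum_congr rfl this]
  exact LinearMap.congr_fun key p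

theorem pPush_mul_pullback [CharZero K] {σ : I → J} (hσ : Function.Surjective σ) (f : P K I)
    (g : P K J) : pPush K hσ (f * pPullback K σ g) = pPush K hσ f * g := by
  obtain ⟨q, rfl⟩ := P.mk_surjective K g
  induction q using MvPolynomial.induction_on generalizing f with
  | C a =>
    have h (L : Type v) [Fintype L] : P.mk K L (C a) = algebraMap K (P K L) a :=
      (P.mk K L).commutes a
    rw [h, AlgHom.commutes, mul_comm, ← Algebra.smul_def, map_smul, mul_comm, ← Algebra.smul_def]
  | add p q hp hq => simp only [map_add, mul_add, hp, hq]
  | mul_X p j hp =>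
    rw [map_mul (P.mk K J), map_mul (pPullback K σ), ← mul_assoc, ← mul_assoc, ← hp]
    obtain ⟨r, hr⟩ := P.mk_surjective K (f * pPullback K σ (P.mk K J p))
    rw [← hr, pPullback_mk, ← map_mul, pPush_mk, pPush_mk, polyPush_mul_pullback_X hσ, map_mul]

theorem sum_pushExp {σ : I → J} (hσ : Function.Surjective σ) (ν : I →₀ ℕ) :
    ∑ j : J, pushExp σ ν j + Fintype.card J = ∑ i : I, ν i + Fintype.card I := by
  classical
  have h1 : ∑ j : J, (pushExp σ ν j + 1) = ∑ j : J, ∑ i : I with σ i = j, (ν i + 1) :=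
    Finset.sum_congr rfl fun j _ => by
      rw [pushExp_add_one hσ]
  rw [Finset.sum_fiberwise Finset.univ σ fun i => ν i + 1] at h1
  simpa [Finset.sum_add_distrib] using h1

/-- The integral of a divided monomial depends only on its degree plus the number of variables, and
`sum_pushExp` says that this number is preserved. -/
theorem integral_pPush [CharZero K] [Nonempty I] [Nonempty J] {σ : I → J}
    (hσ : Function.Surjective σ) (f : P K I) :
    integral K J (pPush K hσ f) = integral K I f := by
  have key : integral K J ∘ₗ pPush K hσ ∘ₗ (P.mk K I).toLinearMap =
      integral K I ∘ₗ (P.mk K I).toLinearMap := by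
    refine linearMap_ext_divMonomial fun ν => ?_
    simp only [LinearMap.comp_apply, AlgHom.toLinearMap_apply, pPush_mk, integral_mk,
      polyPush_divMonomial, polyInt_divMonomial]
    have := sum_pushExp hσ ν
    have h1 : 0 < Fintype.card I := Fintype.card_pos
    have h2 : 0 < Fintype.card J := Fintype.card_pos
    congr 3
    omega
  obtain ⟨p, rfl⟩ := P.mk_surjective K f
  exact LinearMap.congr_fun key p

theorem integral_pPush_mul [CharZero K] [Nonempty I] [Nonempty J] {σ : I → J}
    (hσ : Function.Surjective σ) (f : P K I) (g : P K J) :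
    integral K J (pPush K hσ f * g) = integral K I (f * pPullback K σ g) := by
  rw [← pPush_mul_pullback, integral_pPush]

/-! ### Stokes' theorem -/

theorem integral_pPullback_face [CharZero K] [Nonempty I] {σ : I → J} (hσ : Function.Injective σ)
    {j : J} (hj : Set.range σ = {j}ᶜ) (ν : J →₀ ℕ) :
    integral K I (pPullback K σ (P.mk K J (divMonomial K ν))) =
      if ν j = 0 then ((Fintype.card J - 2 + ∑ i : J, ν i)! : K)⁻¹ else 0 := by
  have hj' : j ∉ Set.range σ := by simp [hj]
  rw [pPullback_mk, integral_mk]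
  split_ifs with h
  · rw [polyPullback_divMonomial hσ, polyInt_divMonomial]
    · have h1 : ∑ i : I, (ν.comapDomain σ hσ.injOn) i = ∑ k : J, ν k :=
        Fintype.sum_of_injective σ hσ _ _ (fun k hk => by
          rw [hj] at hk
          rw [show k = j by simpa using hk, h]) fun _ => rfl
      have h2 : Fintype.card J = Fintype.card I + 1 := by
        classical
        have := Set.ncard_add_ncard_compl {j}
        rw [← hj, Set.ncard_singleton, Set.ncard_range_of_injective hσ, Nat.card_eq_fintype_card,
          Nat.card_eq_fintype_card] at this
        omega
      rw [h1, h2]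
      rfl
    · intro k hk
      rw [hj] at hk
      rw [show k = j by simpa using hk, h]
  · rw [polyPullback_divMonomial_of_ne_zero hj' h, map_zero]

/-- The nonzero value is the same factorial as in `integral_pPullback_face`, but it occurs in the
complementary case for `ν i`. At least two variables are needed, since `card I - 2` is a truncated
subtraction. -/
theorem polyInt_pderiv_divMonomial [CharZero K] (hI : 1 < Fintype.card I) (i : I) (ν : I →₀ ℕ) :
    polyInt K I (pderiv i (divMonomial K ν)) =
      if ν i = 0 then 0 else ((Fintype.card I - 2 + ∑ i : I, ν i)! : K)⁻¹ := by
  classical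
  split_ifs with h
  · rw [pderiv_divMonomial_of_eq_zero h, map_zero]
  · obtain ⟨κ, rfl⟩ := exists_eq_single_add h
    rw [pderiv_divMonomial_add, polyInt_divMonomial]
    have : ∑ k : I, (Finsupp.single i 1 + κ : I →₀ ℕ) k = 1 + ∑ k : I, κ k := by
      simp [Finset.sum_add_distrib, Finsupp.single_apply]
    rw [this]
    congr 3
    omega

/-- The `P_I`-linear extension `P_I ⊗ W_I → P_I` of a linear form on `W_I`. -/
def coeffMap {V : Type*} [AddCommGroup V] [Module K V] (c : V →ₗ[K] K) :
    P K I ⊗[K] V →ₗ[K] P K I :=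
  (TensorProduct.rid K (P K I)).toLinearMap ∘ₗ TensorProduct.map LinearMap.id c

theorem coeffMap_tmul {V : Type*} [AddCommGroup V] [Module K V] (c : V →ₗ[K] K) (f : P K I)
    (v : V) : coeffMap c (f ⊗ₜ[K] v) = c v • f :=
  rfl

/-- For a divided monomial, exactly one of `∫ ∂_i` and the integral over the facet opposite `i` is
nonzero, and its value does not depend on `i`. The two sides therefore differ by this value times `∑
c (dt_i)`, which is zero because `∑ dt_i = 0`. -/
theorem integral_coeffMap_dFun [CharZero K] [Nonempty I] (hI : 1 < Fintype.card I)
    (c : W K I →ₗ[K] K) {F : I → Type v} [∀ i, Fintype (F i)] [∀ i, Nonempty (F i)]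
    (σ : ∀ i, F i → I) (hσ : ∀ i, Function.Injective (σ i)) (hr : ∀ i, Set.range (σ i) = {i}ᶜ)
    (f : P K I) :
    integral K I (coeffMap c (dFun K I f)) =
      -∑ i, c (dt K i) * integral K (F i) (pPullback K (σ i) f) := by
  have key : integral K I ∘ₗ coeffMap c ∘ₗ dFun K I ∘ₗ (P.mk K I).toLinearMap =
      -∑ i, c (dt K i) • (integral K (F i) ∘ₗ (pPullback K (σ i)).toLinearMap ∘ₗ
        (P.mk K I).toLinearMap) := by
    refine linearMap_ext_divMonomial fun ν => ?_
    simp only [LinearMap.comp_apply, AlgHom.toLinearMap_apply, dFun_mk, map_sum, coeffMap_tmul,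
      map_smul, integral_mk, polyInt_pderiv_divMonomial hI, LinearMap.neg_apply,
      LinearMap.sum_apply, LinearMap.smul_apply, integral_pPullback_face (hσ _) (hr _),
      smul_eq_mul]
    rw [eq_neg_iff_add_eq_zero, ← Finset.sum_add_distrib]
    have h0 : ∑ i, c (dt K i) = 0 := by rw [← map_sum, sum_dt, map_zero]
    refine Eq.trans ?_ ((congrArg (· * ((Fintype.card I - 2 + ∑ i : I, ν i)! : K)⁻¹) h0).trans
      (zero_mul _))
    simp only [Finset.sum_mul]
    refine Finset.sum_congr rfl fun i _ => ?_
    split_ifs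
    · rw [mul_zero, zero_add]
    · rw [mul_zero, add_zero]
  obtain ⟨p, rfl⟩ := P.mk_surjective K f
  have := LinearMap.congr_fun key p
  simpa using this

end Polynomials

/-! ### Nondegeneracy of the weighted integral pairing -/

section Nondegenerate

set_option linter.unusedSectionVars false

variable {K : Type u} [Field K] [CharZero K] {I : Type v} [Fintype I]

/-- Replacing `κ` by `κ + e_i` multiplies the term of `μ` by `κ i + κ₀ i + μ i + 1`. Subtracting `κ
i + κ₀ i + ν i + 1` times the original relation removes the term of `ν` and multiplies `c μ` by `μ i
- ν i`, so induction applies to `S` without `ν`. Choosing `i` with `μ i ≠ ν i` shows that `c μ = 0`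
for all `μ ≠ ν`, and then `κ = 0` gives `c ν = 0`. -/
theorem eq_zero_of_sum_factorial_eq_zero (S : Finset (I →₀ ℕ)) (c : (I →₀ ℕ) → K) (κ₀ : I →₀ ℕ)
    (h : ∀ κ : I →₀ ℕ, ∑ μ ∈ S, c μ * ((∏ i : I, ((κ + (κ₀ + μ) : I →₀ ℕ) i)! : ℕ) : K) = 0) :
    ∀ μ ∈ S, c μ = 0 := by
  classical
  induction S using Finset.strongInduction generalizing c with
  | H S ih =>
    intro ν hν
    have hne : ∀ μ ∈ S, μ ≠ ν → c μ = 0 := by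
      intro μ hμ hμν
      obtain ⟨i, hi⟩ := DFunLike.ne_iff.1 hμν
      have := ih (S.erase ν) (Finset.erase_ssubset hν) (fun μ => ((μ i : K) - ν i) * c μ) ?_ μ
        (Finset.mem_erase.2 ⟨hμν, hμ⟩)
      · refine (mul_eq_zero.1 this).resolve_left ?_
        exact fun h0 => hi (by exact_mod_cast sub_eq_zero.1 h0)
      · intro κ
        rw [Finset.sum_erase _ (by rw [sub_self, zero_mul, zero_mul])]
        have h1 := h (Finsupp.single i 1 + κ)
        have h2 := h κ
        simp only [add_assoc, prod_factorial_add_single] at h1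
        have h3 : ∑ μ ∈ S, ((μ i : K) - ν i) * c μ *
              ((∏ i : I, ((κ + (κ₀ + μ) : I →₀ ℕ) i)! : ℕ) : K) =
            ∑ μ ∈ S, c μ * ((((κ + (κ₀ + μ) : I →₀ ℕ) i + 1) *
              ∏ i : I, ((κ + (κ₀ + μ) : I →₀ ℕ) i)! : ℕ) : K) -
            (κ i + κ₀ i + 1 + ν i : K) *
              ∑ μ ∈ S, c μ * ((∏ i : I, ((κ + (κ₀ + μ) : I →₀ ℕ) i)! : ℕ) : K) := by
          rw [Finset.mul_sum, ← Finset.sum_sub_distrib]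
          refine Finset.sum_congr rfl fun μ _ => ?_
          rw [Nat.cast_mul]
          simp only [Finsupp.add_apply, Nat.cast_add, Nat.cast_one]
          ring
        rw [h3, h1, h2, mul_zero, sub_zero]
    have h0 := h 0
    rw [Finset.sum_eq_single_of_mem ν hν fun μ hμ hμν => by rw [hne μ hμ hμν, zero_mul]] at h0
    exact (mul_eq_zero.1 h0).resolve_right (prod_factorial_ne_zero _)

/-- Since `∑ t_i = 1` in `P_I`, multiplying by powers of this sum brings all summands to a common
degree. -/
theorem P.exists_isHomogeneous (f : P K I) :
    ∃ (n : ℕ) (p : MvPolynomial I K), p.IsHomogeneous n ∧ P.mk K I p = f := by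
  obtain ⟨p, rfl⟩ := P.mk_surjective K f
  have hs : P.mk K I (∑ i, X i) = 1 := by
    have := P.mk_relation_mul K (I := I) 1
    rw [mul_one, map_sub, map_one, sub_eq_zero] at this
    exact this.symm
  have hS : (∑ i : I, (X i : MvPolynomial I K)).IsHomogeneous 1 :=
    IsHomogeneous.sum _ _ _ fun i _ => isHomogeneous_X K i
  induction p using MvPolynomial.induction_on' with
  | monomial ν a => exact ⟨_, monomial ν a, isHomogeneous_monomial a rfl, rfl⟩
  | add p q hp hq =>
    obtain ⟨m, p', hp', hp⟩ := hp
    obtain ⟨n, q', hq', hq⟩ := hq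
    refine ⟨m + n, p' * (∑ i, X i) ^ n + (∑ i, X i) ^ m * q', ?_, ?_⟩
    · have h1 := hp'.mul (hS.pow n)
      have h2 := (hS.pow m).mul hq'
      rw [one_mul] at h1 h2
      exact h1.add h2
    · simp only [map_add, map_mul, map_pow, hs, one_pow, mul_one, one_mul, hp, hq]

/-- For a homogeneous representative, all terms of the integral against a monomial have the same
factorial in the denominator. Cancelling it leaves the relations of
`eq_zero_of_sum_factorial_eq_zero`. The weight `κ₀` allows test functions that vanish on the
boundary. -/
theorem integral_nondegenerate [Nonempty I] (κ₀ : I →₀ ℕ) (f : P K I)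
    (h : ∀ g, integral K I (P.mk K I (monomial κ₀ 1) * f * g) = 0) : f = 0 := by
  obtain ⟨n, p, hp, rfl⟩ := P.exists_isHomogeneous f
  suffices ∀ μ ∈ p.support, p.coeff μ = 0 by
    have hp0 : p = 0 := by
      ext μ
      by_cases hμ : μ ∈ p.support
      · exact this μ hμ
      · exact notMem_support_iff.1 hμ
    rw [hp0, map_zero]
  refine eq_zero_of_sum_factorial_eq_zero p.support (fun μ => p.coeff μ) κ₀ fun κ => ?_
  have h1 := h (P.mk K I (monomial κ 1))
  rw [← map_mul, ← map_mul, integral_mk] at h1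
  have h2 : monomial κ₀ 1 * p * monomial κ 1 =
      ∑ μ ∈ p.support, p.coeff μ • monomial (κ + (κ₀ + μ)) (1 : K) := by
    conv_lhs => rw [p.as_sum]
    rw [Finset.mul_sum, Finset.sum_mul]
    refine Finset.sum_congr rfl fun μ _ => ?_
    rw [monomial_mul, monomial_mul, smul_monomial, add_comm _ κ]
    simp
  rw [h2, map_sum] at h1
  have h3 : ∀ μ ∈ p.support, polyInt K I (p.coeff μ • monomial (κ + (κ₀ + μ)) 1) =
      (p.coeff μ * ((∏ i : I, ((κ + (κ₀ + μ) : I →₀ ℕ) i)! : ℕ) : K)) *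
        ((Fintype.card I - 1 + (∑ i, κ i + ∑ i, κ₀ i + n))! : K)⁻¹ := by
    intro μ hμ
    have hn : ∑ i, μ i = n := by
      rw [← hp (mem_support_iff.1 hμ), show (1 : I → ℕ) = fun _ => 1 from rfl,
        ← Finsupp.degree_eq_weight_one, Finsupp.degree_eq_sum]
    rw [map_smul, polyInt_monomial, smul_eq_mul, ← hn, div_eq_mul_inv, mul_assoc]
    simp only [Finsupp.add_apply, Finset.sum_add_distrib, add_assoc]
  rw [Finset.sum_congr rfl h3, ← Finset.sum_mul] at h1
  exact (mul_eq_zero.1 h1).resolve_right (inv_ne_zero (Nat.cast_ne_zero.2 (Nat.factorial_ne_zero _)))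

end Nondegenerate

/-! ### Integration along the fibres of a codegeneracy -/

section Fibre

set_option linter.unusedSectionVars false

variable {K : Type u} [Field K] [CharZero K] {I : Type v} [Fintype I]

/-- The map `Option I → I` which is the identity on `I` and takes the additional point to `y`. -/
def collapse (y : I) : Option I → I := fun o => o.getD y

theorem collapse_surjective (y : I) : Function.Surjective (collapse y) := fun i => ⟨some i, rfl⟩

open scoped Classical in
/-- The section of `collapse y` which takes `y` to the additional point. -/
def splitNone (y : I) : I → Option I := fun i => if i = y then none else some i

theorem splitNone_self (y : I) : splitNone y y = none := if_pos rfl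

theorem splitNone_of_ne {y i : I} (h : i ≠ y) : splitNone y i = some i := if_neg h

theorem splitNone_injective (y : I) : Function.Injective (splitNone y) := by
  intro i j h
  unfold splitNone at h
  split_ifs at h with h1 h2 <;> simp_all

theorem range_splitNone (y : I) : Set.range (splitNone y) = {some y}ᶜ := by
  ext o
  cases o with
  | none => simpa using ⟨y, splitNone_self y⟩
  | some i =>
    simp only [Set.mem_range, Set.mem_compl_iff, Set.mem_singleton_iff, Option.some.injEq]
    refine ⟨?_, fun h => ⟨i, splitNone_of_ne h⟩⟩
    rintro ⟨j, hj⟩ rfl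
    unfold splitNone at hj
    split_ifs at hj with h
    simp_all

theorem pushExp_collapse (y : I) (ν : Option I →₀ ℕ) (i : I) :
    pushExp (collapse y) ν i = ν (some i) + Finsupp.single y (ν none + 1) i := by
  classical
  have := pushExp_add_one (collapse_surjective y) ν i
  rw [Finset.sum_filter, Fintype.sum_option] at this
  rw [Fintype.sum_eq_single i] at this
  swap
  · intro k hk
    exact if_neg hk
  have h2 : collapse y (some i) = i := rfl
  rw [if_pos h2] at this
  by_cases hy : y = i
  · have h1 : collapse y none = i := hy
    rw [if_pos h1] at this
    subst hy
    rw [Finsupp.single_eq_same]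
    omega
  · have h1 : ¬collapse y none = i := hy
    rw [if_neg h1] at this
    rw [Finsupp.single_eq_of_ne (Ne.symm hy)]
    omega

theorem pushExp_collapse_single_some (y i : I) (ν : Option I →₀ ℕ) :
    pushExp (collapse y) (Finsupp.single (some i) 1 + ν) =
      Finsupp.single i 1 + pushExp (collapse y) ν :=
  pushExp_add_single (collapse_surjective y) ν (some i)

theorem polyPush_pderiv_some_of_ne {y i : I} (hi : i ≠ y) (p : MvPolynomial (Option I) K) :
    polyPush K (collapse y) (pderiv (some i) p) = pderiv i (polyPush K (collapse y) p) := by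
  have key : polyPush K (collapse y) ∘ₗ (pderiv (some i)).toLinearMap =
      (pderiv i).toLinearMap ∘ₗ polyPush K (collapse y) := by
    refine linearMap_ext_divMonomial fun ν => ?_
    change polyPush K (collapse y) (pderiv (some i) _) = pderiv i (polyPush K (collapse y) _)
    by_cases h : ν (some i) = 0
    · rw [pderiv_divMonomial_of_eq_zero h, map_zero, polyPush_divMonomial,
        pderiv_divMonomial_of_eq_zero]
      rw [pushExp_collapse, h, Finsupp.single_eq_of_ne hi, add_zero]
    · obtain ⟨κ, rfl⟩ := exists_eq_single_add h
      rw [pderiv_divMonomial_add, polyPush_divMonomial, polyPush_divMonomial,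
        pushExp_collapse_single_some, pderiv_divMonomial_add]
  exact LinearMap.congr_fun key p

/-- `polyPush K (collapse y)` integrates over the segment `t_none + t_y = s_y`: the monomial `t_y^a
t_none^b / (a! b!)` goes to `s_y^(a+b+1) / (a+b+1)!`. Differentiating with respect to the length
`s_y` adds an end-point value to the integral of the derivative. Here the end point is `t_y = 0`,
which is the facet `splitNone y`; in `polyPush_pderiv_none` it is `t_none = 0`, the facet `some`. -/
theorem polyPush_pderiv_some_self (y : I) (p : MvPolynomial (Option I) K) :
    polyPush K (collapse y) (pderiv (some y) p) =
      pderiv y (polyPush K (collapse y) p) - polyPullback K (splitNone y) p := by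
  have key : polyPush K (collapse y) ∘ₗ (pderiv (some y)).toLinearMap =
      (pderiv y).toLinearMap ∘ₗ polyPush K (collapse y) -
        (polyPullback K (splitNone y)).toLinearMap := by
    refine linearMap_ext_divMonomial fun ν => ?_
    change polyPush K (collapse y) (pderiv (some y) _) =
      pderiv y (polyPush K (collapse y) _) - polyPullback K (splitNone y) _
    have hr : some y ∉ Set.range (splitNone y) := by simp [range_splitNone]
    by_cases h : ν (some y) = 0
    · have hν : pushExp (collapse y) ν = Finsupp.single y 1 +
          ν.comapDomain (splitNone y) (splitNone_injective y).injOn := by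
        ext i
        rw [pushExp_collapse, Finsupp.add_apply, Finsupp.comapDomain_apply]
        by_cases hi : i = y
        · subst hi
          rw [splitNone_self, h, Finsupp.single_eq_same, Finsupp.single_eq_same]
          omega
        · rw [splitNone_of_ne hi, Finsupp.single_eq_of_ne hi, Finsupp.single_eq_of_ne hi, add_comm]
      rw [pderiv_divMonomial_of_eq_zero h, map_zero, polyPush_divMonomial,
        polyPullback_divMonomial (splitNone_injective y), hν, pderiv_divMonomial_add, sub_self]
      intro o ho
      rw [range_splitNone, Set.notMem_compl_iff] at ho
      rw [ho, h]
    · rw [polyPullback_divMonomial_of_ne_zero hr h, sub_zero]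
      obtain ⟨κ, rfl⟩ := exists_eq_single_add h
      rw [pderiv_divMonomial_add, polyPush_divMonomial, polyPush_divMonomial,
        pushExp_collapse_single_some, pderiv_divMonomial_add]
  exact LinearMap.congr_fun key p

theorem polyPush_pderiv_none (y : I) (p : MvPolynomial (Option I) K) :
    polyPush K (collapse y) (pderiv none p) =
      pderiv y (polyPush K (collapse y) p) - polyPullback K some p := by
  have key : polyPush K (collapse y) ∘ₗ (pderiv none).toLinearMap =
      (pderiv y).toLinearMap ∘ₗ polyPush K (collapse y) - (polyPullback K some).toLinearMap := by
    refine linearMap_ext_divMonomial fun ν => ?_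
    change polyPush K (collapse y) (pderiv none _) =
      pderiv y (polyPush K (collapse y) _) - polyPullback K some _
    have hr : (none : Option I) ∉ Set.range (some : I → Option I) := by simp
    have hinj : Function.Injective (some : I → Option I) := Option.some_injective I
    by_cases h : ν none = 0
    · have hν : pushExp (collapse y) ν = Finsupp.single y 1 +
          ν.comapDomain some hinj.injOn := by
        ext i
        rw [pushExp_collapse, Finsupp.add_apply, Finsupp.comapDomain_apply, h, add_comm]
      rw [pderiv_divMonomial_of_eq_zero h, map_zero, polyPush_divMonomial,
        polyPullback_divMonomial hinj, hν, pderiv_divMonomial_add, sub_self]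
      intro o ho
      cases o with
      | none => exact h
      | some i => exact absurd ⟨i, rfl⟩ ho
    · rw [polyPullback_divMonomial_of_ne_zero hr h, sub_zero]
      obtain ⟨κ, rfl⟩ := exists_eq_single_add h
      have := pushExp_add_single (collapse_surjective y) κ none
      rw [show collapse y none = y from rfl] at this
      rw [pderiv_divMonomial_add, polyPush_divMonomial, polyPush_divMonomial,
        this, pderiv_divMonomial_add]
  exact LinearMap.congr_fun key p

variable {J : Type v} [Fintype J]

theorem polyPullback_polyPush_collapse {σ : J → I} (hσ : Function.Injective σ) (y : J)
    (p : MvPolynomial (Option I) K) :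
    polyPullback K σ (polyPush K (collapse (σ y)) p) =
      polyPush K (collapse y) (polyPullback K (Option.map σ) p) := by
  have key : (polyPullback K σ).toLinearMap ∘ₗ polyPush K (collapse (σ y)) =
      polyPush K (collapse y) ∘ₗ (polyPullback K (Option.map σ)).toLinearMap := by
    refine linearMap_ext_divMonomial fun ν => ?_
    simp only [LinearMap.comp_apply, AlgHom.toLinearMap_apply, polyPush_divMonomial]
    have hσ' := Option.map_injective hσ
    by_cases h : ∀ o ∉ Set.range (Option.map σ), ν o = 0
    · rw [polyPullback_divMonomial hσ, polyPullback_divMonomial hσ' h, polyPush_divMonomial]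
      · congr 1
        ext j
        rw [Finsupp.comapDomain_apply, pushExp_collapse, pushExp_collapse,
          Finsupp.comapDomain_apply, Finsupp.comapDomain_apply, Option.map_some, Option.map_none]
        congr 1
        by_cases hj : j = y
        · rw [hj, Finsupp.single_eq_same, Finsupp.single_eq_same]
        · rw [Finsupp.single_eq_of_ne hj, Finsupp.single_eq_of_ne (hσ.ne hj)]
      · intro i hi
        rw [pushExp_collapse, Finsupp.single_eq_of_ne, h, add_zero]
        · rintro ⟨o, ho⟩
          cases o with
          | none => simp at ho
          | some j => exact hi ⟨j, by simpa using ho⟩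
        · rintro rfl
          exact hi ⟨y, rfl⟩
    · push Not at h
      obtain ⟨o, ho, hν⟩ := h
      rw [polyPullback_divMonomial_of_ne_zero ho hν, map_zero]
      cases o with
      | none => exact absurd ⟨none, rfl⟩ ho
      | some i =>
        refine polyPullback_divMonomial_of_ne_zero (j := i) ?_ ?_
        · rintro ⟨j, rfl⟩
          exact ho ⟨some j, rfl⟩
        · rw [pushExp_collapse]
          omega
  exact LinearMap.congr_fun key p

/-- Over the locus `s_y = 0` the segment has length zero: every fibre integral is divisible by the
variable of `y`. -/
theorem polyPullback_polyPush_collapse_of_notMem {σ : J → I} {y : I}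
    (hy : y ∉ Set.range σ) (p : MvPolynomial (Option I) K) :
    polyPullback K σ (polyPush K (collapse y) p) = 0 := by
  have key : (polyPullback K σ).toLinearMap ∘ₗ polyPush K (collapse y) = 0 := by
    refine linearMap_ext_divMonomial fun ν => ?_
    simp only [LinearMap.comp_apply, AlgHom.toLinearMap_apply, polyPush_divMonomial]
    rw [polyPullback_divMonomial_of_ne_zero hy]
    · rfl
    · rw [pushExp_collapse, Finsupp.single_eq_same]
      omega
  exact LinearMap.congr_fun key p

end Fibre

/-! ### The de Rham complex and its functoriality -/

section Forms

set_option linter.unusedSectionVars false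

variable {K : Type u} [Field K] {I : Type v} [Fintype I]

/-- The product `P_I ⊗ W_I → Ω^m_I → Ω^{m+1}_I` with a form in `Λ^m(W_I)`. -/
def wedgeForm (m : ℕ) (ω : ⋀[K]^m (W K I)) : P K I ⊗[K] W K I →ₗ[K] Om K I (m + 1) :=
  TensorProduct.map LinearMap.id ((wedge K (W K I) m).flip ω)

theorem wedgeForm_tmul (m : ℕ) (ω : ⋀[K]^m (W K I)) (f : P K I) (w : W K I) :
    wedgeForm m ω (f ⊗ₜ[K] w) = f ⊗ₜ[K] wedge K (W K I) m w ω :=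
  rfl

theorem deRham_tmul (m : ℕ) (f : P K I) (ω : ⋀[K]^m (W K I)) :
    deRham K I m (f ⊗ₜ[K] ω) = wedgeForm m ω (dFun K I f) := by
  rw [deRham, LinearMap.comp_apply, LinearMap.comp_apply, TensorProduct.map_tmul]
  generalize dFun K I f = x
  induction x using TensorProduct.induction_on with
  | zero => simp
  | add x y hx hy => simp only [TensorProduct.add_tmul, map_add, hx, hy]
  | tmul g w => rfl

theorem deRham_mk_tmul (m : ℕ) (p : MvPolynomial I K) (ω : ⋀[K]^m (W K I)) :
    deRham K I m (P.mk K I p ⊗ₜ[K] ω) =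
      ∑ i : I, P.mk K I (pderiv i p) ⊗ₜ[K] wedge K (W K I) m (dt K i) ω := by
  rw [deRham_tmul, dFun_mk, map_sum]
  rfl

theorem pderiv_pderiv_comm (i j : I) (p : MvPolynomial I K) :
    pderiv i (pderiv j p) = pderiv j (pderiv i p) := by
  classical
  have h : ⁅(pderiv i : Derivation K (MvPolynomial I K) (MvPolynomial I K)),
      (pderiv j : Derivation K (MvPolynomial I K) (MvPolynomial I K))⁆ = 0 := by
    refine MvPolynomial.derivation_ext fun k => ?_
    rw [Derivation.commutator_apply]
    simp only [pderiv_X, Pi.single_apply]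
    split_ifs <;> simp
  have := DFunLike.congr_fun h p
  rwa [Derivation.commutator_apply, Derivation.zero_apply, sub_eq_zero] at this

/-- Second partial derivatives are symmetric and the wedge is antisymmetric, so the double sum
equals its own negative. -/
theorem deRham_comp_deRham [CharZero K] (m : ℕ) : deRham K I (m + 1) ∘ₗ deRham K I m = 0 := by
  refine TensorProduct.ext' fun f ω => ?_
  obtain ⟨p, rfl⟩ := P.mk_surjective K f
  rw [LinearMap.comp_apply, deRham_mk_tmul, map_sum]
  simp only [deRham_mk_tmul]
  set S := ∑ i : I, ∑ j : I, P.mk K I (pderiv j (pderiv i p)) ⊗ₜ[K]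
    wedge K (W K I) (m + 1) (dt K j) (wedge K (W K I) m (dt K i) ω) with hS
  have : S = -S := by
    conv_lhs => rw [hS, Finset.sum_comm]
    rw [hS, ← Finset.sum_neg_distrib]
    refine Finset.sum_congr rfl fun i _ => ?_
    rw [← Finset.sum_neg_distrib]
    refine Finset.sum_congr rfl fun j _ => ?_
    rw [wedge_wedge_swap, pderiv_pderiv_comm, TensorProduct.tmul_neg]
  have h2 : (2 : K) • S = 0 := by rw [two_smul, eq_neg_iff_add_eq_zero.1 this]
  exact (smul_eq_zero.1 h2).resolve_left two_ne_zero

theorem hatDelta_comp_hatDelta [CharZero K] (m : ℕ) :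
    hatDelta K I m ∘ₗ hatDelta K I (m + 1) = 0 := by
  refine LinearMap.ext fun l => LinearMap.ext fun x => ?_
  change (-1 : K) ^ (m + 1) * ((-1 : K) ^ (m + 1 + 1) *
    l ((deRham K I (m + 1) ∘ₗ deRham K I m) x)) = 0
  rw [deRham_comp_deRham, LinearMap.zero_apply, map_zero, mul_zero, mul_zero]

variable {J L : Type v} [Fintype J] [Fintype L]

theorem omPullback_tmul (σ : I → J) (m : ℕ) (f : P K J) (ω : ⋀[K]^m (W K J)) :
    omPullback K σ m (f ⊗ₜ[K] ω) =
      pPullback K σ f ⊗ₜ[K] exteriorPower.map m (wPullback K σ) ω :=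
  rfl

theorem deRham_omPullback (σ : I → J) (m : ℕ) (x : Om K J m) :
    deRham K I m (omPullback K σ m x) = omPullback K σ (m + 1) (deRham K J m x) := by
  induction x using TensorProduct.induction_on with
  | zero => simp only [map_zero]
  | add x y hx hy => simp only [map_add, hx, hy]
  | tmul f ω =>
    rw [omPullback_tmul, deRham_tmul, deRham_tmul, dFun_pPullback]
    generalize dFun K J f = x
    induction x using TensorProduct.induction_on with
    | zero => simp only [map_zero]
    | add x y hx hy => simp only [map_add, hx, hy]
    | tmul g w =>
      rw [TensorProduct.map_tmul, wedgeForm_tmul, wedgeForm_tmul, omPullback_tmul,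
        exteriorPower_map_wedge]
      rfl

theorem hatDelta_dualMap_omPullback (σ : I → J) (m : ℕ) (l : HatPhi K I (m + 1)) :
    hatDelta K J m ((omPullback K σ (m + 1)).dualMap l) =
      (omPullback K σ m).dualMap (hatDelta K I m l) := by
  refine LinearMap.ext fun x => ?_
  change (-1 : K) ^ (m + 1) * l (omPullback K σ (m + 1) (deRham K J m x)) =
    (-1 : K) ^ (m + 1) * l (deRham K I m (omPullback K σ m x))
  rw [deRham_omPullback]

theorem polyPullback_comp (σ : I → J) (τ : J → L) (p : MvPolynomial L K) :
    polyPullback K (τ ∘ σ) p = polyPullback K σ (polyPullback K τ p) := by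
  classical
  have : polyPullback K (τ ∘ σ) = (polyPullback K σ).comp (polyPullback K τ) := by
    refine MvPolynomial.algHom_ext fun l => ?_
    simp only [polyPullback, AlgHom.comp_apply, aeval_X, map_sum, Function.comp_apply]
    rw [← Finset.sum_fiberwise_of_maps_to (s := Finset.univ.filter fun i => τ (σ i) = l)
      (t := Finset.univ.filter fun j => τ j = l) (g := σ)]
    · refine Finset.sum_congr rfl fun j hj => ?_
      refine Finset.sum_congr ?_ fun _ _ => rfl
      ext i
      simp only [Finset.mem_filter, Finset.mem_univ, true_and] at hj ⊢
      refine ⟨fun h => h.2, fun h => ⟨by rw [h, hj], h⟩⟩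
    · intro i hi
      simpa using hi
  exact DFunLike.congr_fun this p

theorem polyPullback_id (p : MvPolynomial I K) : polyPullback K (id : I → I) p = p := by
  have : polyPullback K (id : I → I) = AlgHom.id K _ := by
    refine MvPolynomial.algHom_ext fun i => ?_
    rw [AlgHom.id_apply]
    exact polyPullback_X_apply Function.injective_id i
  exact DFunLike.congr_fun this p

theorem pPullback_comp (σ : I → J) (τ : J → L) (f : P K L) :
    pPullback K (τ ∘ σ) f = pPullback K σ (pPullback K τ f) := by
  obtain ⟨p, rfl⟩ := P.mk_surjective K f
  rw [pPullback_mk, polyPullback_comp]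
  rfl

theorem pPullback_id (f : P K I) : pPullback K (id : I → I) f = f := by
  obtain ⟨p, rfl⟩ := P.mk_surjective K f
  rw [pPullback_mk, polyPullback_id]

theorem wPullback_comp (σ : I → J) (τ : J → L) :
    wPullback K (τ ∘ σ) = wPullback K σ ∘ₗ wPullback K τ := by
  refine Submodule.linearMap_qext _ ?_
  rfl

theorem wPullback_id : wPullback K (id : I → I) = LinearMap.id := by
  refine Submodule.linearMap_qext _ ?_
  rfl

theorem omPullback_comp (σ : I → J) (τ : J → L) (m : ℕ) (x : Om K L m) :
    omPullback K (τ ∘ σ) m x = omPullback K σ m (omPullback K τ m x) := by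
  induction x using TensorProduct.induction_on with
  | zero => simp only [map_zero]
  | add x y hx hy => simp only [map_add, hx, hy]
  | tmul f ω =>
    rw [omPullback_tmul, omPullback_tmul, omPullback_tmul, pPullback_comp, wPullback_comp,
      exteriorPower.map_comp]
    rfl

theorem omPullback_id (m : ℕ) (x : Om K I m) : omPullback K (id : I → I) m x = x := by
  induction x using TensorProduct.induction_on with
  | zero => simp only [map_zero]
  | add x y hx hy => simp only [map_add, hx, hy]
  | tmul f ω =>
    rw [omPullback_tmul, pPullback_id, wPullback_id, exteriorPower.map_id]
    rfl

theorem wPullback_surjective {σ : I → J} (hσ : Function.Injective σ) :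
    Function.Surjective (wPullback K σ) := by
  intro w
  obtain ⟨w, rfl⟩ := Submodule.mkQ_surjective _ w
  exact ⟨(Submodule.span K {(1 : J → K)}).mkQ (Function.extend σ w 0), by
    rw [wPullback_mkQ, Function.extend_comp hσ]⟩

theorem pPullback_surjective {σ : I → J} (hσ : Function.Injective σ) :
    Function.Surjective (pPullback K σ) := by
  intro f
  obtain ⟨p, rfl⟩ := P.mk_surjective K f
  refine ⟨P.mk K J (rename σ p), ?_⟩
  rw [pPullback_mk]
  congr 1
  have : (polyPullback K σ).comp (rename σ) = AlgHom.id K _ := by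
    refine MvPolynomial.algHom_ext fun i => ?_
    rw [AlgHom.comp_apply, rename_X, polyPullback_X_apply hσ]
    rfl
  exact DFunLike.congr_fun this p

/-! ### Pairings and currents -/

theorem extPairing_surjective (m : ℕ) : Function.Surjective (extPairing K I m) := by
  intro l
  obtain ⟨α, hα⟩ := pairingDual_surjective m l
  refine ⟨(-1 : K) ^ (m * (m - 1) / 2) • α, ?_⟩
  rw [extPairing, LinearMap.smul_apply, map_smul, hα, smul_smul, ← mul_pow, neg_one_mul, neg_neg,
    one_pow, one_smul]

theorem extPairing_apply (m : ℕ) (α : ⋀[K]^m (WDual K I)) (ω : ⋀[K]^m (W K I)) :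
    extPairing K I m α ω =
      (-1 : K) ^ (m * (m - 1) / 2) * exteriorPower.pairingDual K (W K I) m α ω :=
  rfl

theorem extPairing_extPush (σ : I → J) (m : ℕ) (α : ⋀[K]^m (WDual K I)) (ω : ⋀[K]^m (W K J)) :
    extPairing K J m (extPush K σ m α) ω =
      extPairing K I m α (exteriorPower.map m (wPullback K σ) ω) := by
  rw [extPairing_apply, extPairing_apply, extPush, pairingDual_map]

variable (K) in
theorem neg_one_pow_choose_succ (m : ℕ) :
    (-1 : K) ^ (m + 1) * (-1 : K) ^ ((m + 1) * (m + 1 - 1) / 2) =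
      -(-1 : K) ^ (m * (m - 1) / 2) := by
  have h : (m + 1) * (m + 1 - 1) / 2 = m * (m - 1) / 2 + m := by
    rw [← Nat.choose_two_right, ← Nat.choose_two_right, Nat.choose_succ_succ' m 1,
      Nat.choose_one_right, add_comm]
  have h2 : ((-1 : K) ^ m) * (-1) ^ m = 1 := by rw [← mul_pow, neg_one_mul, neg_neg, one_pow]
  generalize (m + 1) * (m + 1 - 1) / 2 = a at h
  generalize m * (m - 1) / 2 = b at h ⊢
  rw [h, pow_add, pow_succ]
  linear_combination (-(-1 : K) ^ b) * h2

/-- This is where the sign conventions meet: the signs of `hatDelta` and of the two pairings combine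
to `-1`, which is the sign built into `interiorMul`. -/
theorem neg_one_pow_mul_extPairing_wedge (m : ℕ) (w : W K I) (α : ⋀[K]^(m + 1) (WDual K I))
    (ω : ⋀[K]^m (W K I)) :
    (-1 : K) ^ (m + 1) * extPairing K I (m + 1) α (wedge K (W K I) m w ω) =
      extPairing K I m (interiorMul K (W K I) m w α) ω := by
  rw [extPairing_apply, extPairing_apply, ← mul_assoc, neg_one_pow_choose_succ, pairingDual_wedge,
    interiorMul_eq, LinearMap.map_neg, LinearMap.neg_apply, mul_neg, neg_mul]

theorem thtPairing_tmul (m : ℕ) (f g : P K I) (α : ⋀[K]^m (WDual K I)) (ω : ⋀[K]^m (W K I)) :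
    thtPairing K I m (f ⊗ₜ[K] α) (g ⊗ₜ[K] ω) = extPairing K I m α ω • (f * g) := by
  rw [thtPairing, LinearMap.compr₂_apply, TensorProduct.map₂_apply_tmul]
  rfl

end Forms

/-! ### The functionals in the image of `xi`, and naturality -/

section Forms

set_option linter.unusedSectionVars false

variable {K : Type u} [Field K] {I J L : Type v} [Fintype I] [Fintype J] [Fintype L]

variable [CharZero K]

variable (K I) in
/-- The functional `ω ↦ ∫_I ⟨α, ω⟩` on `Ω^m_I`. -/
def current [Nonempty I] (m : ℕ) : Tht K I m →ₗ[K] HatPhi K I m :=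
  (thtPairing K I m).compr₂ (integral K I)

theorem current_tmul [Nonempty I] (m : ℕ) (f g : P K I) (α : ⋀[K]^m (WDual K I))
    (ω : ⋀[K]^m (W K I)) :
    current K I m (f ⊗ₜ[K] α) (g ⊗ₜ[K] ω) = extPairing K I m α ω * integral K I (f * g) := by
  change integral K I (thtPairing K I m (f ⊗ₜ[K] α) (g ⊗ₜ[K] ω)) = _
  rw [thtPairing_tmul, map_smul, smul_eq_mul]

theorem current_thtPush [Nonempty I] [Nonempty J] {σ : I → J} (hσ : Function.Surjective σ) (m : ℕ)
    (α : Tht K I m) :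
    current K J m (thtPush K hσ m α) = (omPullback K σ m).dualMap (current K I m α) := by
  have : current K J m ∘ₗ thtPush K hσ m = (omPullback K σ m).dualMap ∘ₗ current K I m := by
    refine TensorProduct.ext' fun f a => ?_
    refine TensorProduct.ext' fun g ω => ?_
    rw [LinearMap.comp_apply, LinearMap.comp_apply, LinearMap.dualMap_apply, omPullback_tmul,
      current_tmul, thtPush, TensorProduct.map_tmul, current_tmul, extPairing_extPush,
      integral_pPush_mul]
  exact LinearMap.congr_fun this α

theorem xi_incl (A : NESub I) (m : ℕ) (α : Tht K A.1 m) :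
    xi K I m (incl K A m α) =
      (omPullback K (fun a : A.1 => (a : I)) m).dualMap (current K A.1 m α) := by
  classical
  rw [xi, Phi.desc, incl, DirectSum.toModule_lof]
  rfl

theorem xi_incl_apply (A : NESub I) (m : ℕ) (α : Tht K A.1 m) (x : Om K I m) :
    xi K I m (incl K A m α) x =
      current K A.1 m α (omPullback K (fun a : A.1 => (a : I)) m x) := by
  rw [xi_incl]
  rfl

theorem current_thtPush_apply [Nonempty I] [Nonempty J] {σ : I → J} (hσ : Function.Surjective σ)
    (m : ℕ) (α : Tht K I m) (x : Om K J m) :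
    current K J m (thtPush K hσ m α) x = current K I m α (omPullback K σ m x) := by
  rw [current_thtPush]
  rfl

theorem Phi.linearMap_ext {m : ℕ} {M : Type*} [AddCommMonoid M] [Module K M]
    {f g : Phi K I m →ₗ[K] M} (h : ∀ A α, f (incl K A m α) = g (incl K A m α)) : f = g := by
  classical
  refine DirectSum.linearMap_ext K fun A => ?_
  refine LinearMap.ext fun α => ?_
  exact h A α

theorem Phi.desc_incl {m : ℕ} {M : Type*} [AddCommMonoid M] [Module K M]
    (f : (A : NESub I) → Tht K A.1 m →ₗ[K] M) (A : NESub I) (α : Tht K A.1 m) :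
    Phi.desc f (incl K A m α) = f A α := by
  classical
  rw [Phi.desc, incl, DirectSum.toModule_lof]

/-- The functional `ω ↦ ∫_L ⟨α, σ^* ω⟩` on `Ω^m_I` defined by a map `σ : L → I` is in the image of
`ξ_I`. -/
theorem dualMap_current_mem_range [Nonempty L] (σ : L → I) (m : ℕ) (α : Tht K L m) :
    (omPullback K σ m).dualMap (current K L m α) ∈ LinearMap.range (xi K I m) := by
  classical
  obtain ⟨A, hA⟩ : ∃ A : NESub I, A.1 = Finset.univ.image σ :=
    ⟨⟨Finset.univ.image σ, Finset.univ_nonempty.image σ⟩, rfl⟩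
  let τ : L → A.1 := fun l => ⟨σ l, hA ▸ Finset.mem_image_of_mem σ (Finset.mem_univ l)⟩
  have hτ : Function.Surjective τ := by
    rintro ⟨a, ha⟩
    obtain ⟨l, -, rfl⟩ := Finset.mem_image.1 (hA ▸ ha)
    exact ⟨l, rfl⟩
  refine ⟨incl K A m (thtPush K hτ m α), ?_⟩
  rw [xi_incl, current_thtPush]
  refine LinearMap.ext fun x => ?_
  exact congrArg (current K L m α) (omPullback_comp τ (fun a : A.1 => (a : I)) m x).symm

theorem push_incl (σ : I → J) (m : ℕ) (A : NESub I) (α : Tht K A.1 m) :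
    push K σ m (incl K A m α) = incl K (imageNE σ A) m
      (thtPush K (toImage_surjective σ A) m α) :=
  Phi.desc_incl (fun A => incl K (imageNE σ A) m ∘ₗ thtPush K (toImage_surjective σ A) m) A α

/-- Both sides pull `x` back along the same map `A → J`, factored once through `σ(A)` and once
through `I`. -/
theorem xi_push_incl (σ : I → J) (m : ℕ) (A : NESub I) (α : Tht K A.1 m) (x : Om K J m) :
    xi K J m (push K σ m (incl K A m α)) x = xi K I m (incl K A m α) (omPullback K σ m x) := by
  have h1 := omPullback_comp (K := K) (toImage σ A) (fun a : (imageNE σ A).1 => (a : J)) m x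
  have h2 := omPullback_comp (K := K) (fun a : A.1 => (a : I)) σ m x
  rw [push_incl, xi_incl_apply, xi_incl_apply, current_thtPush_apply]
  exact congrArg (current K A.1 m α) (h1.symm.trans h2)

theorem xi_push (σ : I → J) (m : ℕ) :
    xi K J m ∘ₗ push K σ m = (omPullback K σ m).dualMap ∘ₗ xi K I m :=
  Phi.linearMap_ext fun A α => LinearMap.ext fun x => xi_push_incl σ m A α x

end Forms

section Forms

set_option linter.unusedSectionVars false

variable {K : Type u} [Field K] {I J L : Type v} [Fintype I] [Fintype J] [Fintype L]

variable [CharZero K]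

/-! ### Injectivity of `ξ` -/

/-- Pairing with the basis of `Λ^m(W_I)` dual to that of `Λ^m(W_I^∨)` extracts one polynomial
coefficient of `α` at a time, to which `integral_nondegenerate` applies. -/
theorem eq_zero_of_current_eq_zero [Nonempty I] (m : ℕ) (κ₀ : I →₀ ℕ) (α : Tht K I m)
    (h : ∀ (g : P K I) (ω : ⋀[K]^m (W K I)),
      current K I m α ((P.mk K I (monomial κ₀ 1) * g) ⊗ₜ[K] ω) = 0) : α = 0 := by
  let b := Module.finBasis K (W K I)
  obtain ⟨c, rfl⟩ := TensorProduct.eq_repr_basis_right (b.dualBasis.exteriorPower m) α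
  suffices c = 0 by rw [this, Finsupp.sum_zero_index]
  ext t
  rw [Finsupp.zero_apply]
  refine integral_nondegenerate κ₀ (c t) fun g => ?_
  have h1 := h g (b.exteriorPower m t)
  rw [Finsupp.sum, map_sum, LinearMap.sum_apply, Finset.sum_eq_single t] at h1
  · rw [current_tmul, extPairing, LinearMap.smul_apply, LinearMap.smul_apply, pairingDual_basis,
      Module.Basis.coord_apply, Module.Basis.repr_self, Finsupp.single_eq_same, smul_eq_mul,
      mul_one] at h1
    rw [mul_comm _ (c t), mul_assoc]
    exact (mul_eq_zero.1 h1).resolve_left (pow_ne_zero _ (neg_ne_zero.2 one_ne_zero))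
  · intro s _ hs
    rw [current_tmul, extPairing, LinearMap.smul_apply, LinearMap.smul_apply, pairingDual_basis,
      Module.Basis.coord_apply, Module.Basis.repr_self, Finsupp.single_eq_of_ne hs, smul_zero,
      zero_mul]
  · intro ht
    rw [Finsupp.notMem_support_iff.1 ht, TensorProduct.zero_tmul, map_zero, LinearMap.zero_apply]

theorem omPullback_prod_X_eq_zero {A B : Finset I} (h : ¬A ⊆ B) (m : ℕ) (g : P K I)
    (ω : ⋀[K]^m (W K I)) :
    omPullback K (fun b : B => (b : I)) m ((P.mk K I (∏ a ∈ A, X a) * g) ⊗ₜ[K] ω) = 0 := by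
  obtain ⟨a, haA, haB⟩ := Finset.not_subset.1 h
  have h0 : polyPullback K (fun b : B => (b : I)) (∏ a ∈ A, X a) = 0 := by
    rw [map_prod]
    refine Finset.prod_eq_zero haA (polyPullback_X_of_notMem ?_)
    rintro ⟨b, rfl⟩
    exact haB b.2
  have h1 : pPullback K (fun b : B => (b : I)) (P.mk K I (∏ a ∈ A, X a) * g) = 0 := by
    rw [map_mul (pPullback K _), pPullback_mk, h0, map_zero (P.mk K B), zero_mul]
  rw [omPullback_tmul, h1, TensorProduct.zero_tmul]

theorem pPullback_prod_X_mul (A : Finset I) (g : P K I) :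
    pPullback K (fun a : A => (a : I)) (P.mk K I (∏ a ∈ A, X a) * g) =
      P.mk K A (monomial (∑ a : A, Finsupp.single a 1) 1) *
        pPullback K (fun a : A => (a : I)) g := by
  have he : monomial (∑ a : A, Finsupp.single a 1) (1 : K) = ∏ a : A, X a := by
    rw [monomial_sum_one]
    rfl
  rw [map_mul (pPullback K _), pPullback_mk, map_prod, ← Finset.prod_coe_sort,
    Finset.prod_congr rfl fun a _ => polyPullback_X_apply (K := K)
      (σ := fun a : A => (a : I)) Subtype.val_injective a, he]

/-- Induction on the codimension of the face. Against forms divisible by `∏ a ∈ A, X a`, faces not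
containing `A` contribute zero, and components at strictly larger faces are already known to vanish.
Only the component at `A` is left. -/
theorem xi_injective (m : ℕ) : Function.Injective (xi K I m) := by
  classical
  refine (injective_iff_map_eq_zero _).2 fun x hx => ?_
  have hsum : ∀ ω, ∑ A : NESub I, current K A.1 m (x A)
      (omPullback K (fun a : A.1 => (a : I)) m ω) = 0 := by
    intro ω
    have h1 : ∑ A : NESub I, incl K A m (x A) = x := DirectSum.sum_univ_of x
    rw [← h1, map_sum] at hx
    simp only [xi_incl] at hx
    have := LinearMap.congr_fun hx ω
    rw [LinearMap.sum_apply] at this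
    exact this
  suffices ∀ (n : ℕ) (A : NESub I), Fintype.card I - A.1.card = n → x A = 0 by
    refine DFinsupp.ext fun A => ?_
    exact this _ A rfl
  intro n
  induction n using Nat.strong_induction_on with
  | _ n ih =>
  intro A hA
  -- The weight is the product of all coordinates of the face, which is the restriction of `∏ a ∈ A,
  -- X a`. The test forms on the face extend to `I` because restriction is surjective.
  refine eq_zero_of_current_eq_zero m (∑ a : A.1, Finsupp.single a 1) (x A) fun g ω => ?_
  obtain ⟨g, rfl⟩ := pPullback_surjective (K := K) (σ := fun a : A.1 => (a : I))
    Subtype.val_injective g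
  obtain ⟨ω, rfl⟩ := exteriorPower.map_surjective (n := m)
    (wPullback_surjective (K := K) (σ := fun a : A.1 => (a : I)) Subtype.val_injective) ω
  have h1 := hsum ((P.mk K I (∏ a ∈ A.1, X a) * g) ⊗ₜ[K] ω)
  rw [Finset.sum_eq_single A] at h1
  · rw [omPullback_tmul, pPullback_prod_X_mul] at h1
    exact h1
  · intro B _ hBA
    by_cases hAB : A.1 ⊆ B.1
    · have hss : A.1 ⊂ B.1 := hAB.ssubset_of_ne fun h => hBA (Subtype.ext h.symm)
      have h2 := Finset.card_lt_card hss
      have h3 := Finset.card_le_univ B.1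
      rw [ih (Fintype.card I - B.1.card) (by omega) B rfl, LinearMap.map_zero, LinearMap.zero_apply]
    · rw [omPullback_prod_X_eq_zero hAB, LinearMap.map_zero]
  · exact fun h => absurd (Finset.mem_univ A) h

end Forms

section Forms

set_option linter.unusedSectionVars false

variable {K : Type u} [Field K] {I J L : Type v} [Fintype I] [Fintype J] [Fintype L]

variable [CharZero K]

/-! ### Compatibility of `ξ` with the differentials -/

theorem dFun_mul (f g : P K I) (c : W K I →ₗ[K] K) :
    coeffMap c (dFun K I (f * g)) = f * coeffMap c (dFun K I g) + g * coeffMap c (dFun K I f) := by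
  obtain ⟨p, rfl⟩ := P.mk_surjective K f
  obtain ⟨q, rfl⟩ := P.mk_surjective K g
  rw [← map_mul, dFun_mk, dFun_mk, dFun_mk]
  simp only [map_sum, coeffMap_tmul, Derivation.leibniz, map_add, smul_eq_mul, map_mul, smul_add,
    Finset.sum_add_distrib, Finset.mul_sum, mul_smul_comm]

theorem map_lift_assoc_tmul {A B C D : Type*} [AddCommGroup A] [Module K A] [AddCommGroup B]
    [Module K B] [AddCommGroup C] [Module K C] [AddCommGroup D] [Module K D]
    (h : B →ₗ[K] C →ₗ[K] D) (x : A ⊗[K] B) (c : C) :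
    TensorProduct.map LinearMap.id (TensorProduct.lift h) (TensorProduct.assoc K A B C (x ⊗ₜ c)) =
      TensorProduct.map LinearMap.id (h.flip c) x := by
  induction x using TensorProduct.induction_on with
  | zero => simp
  | add x y hx hy => simp only [TensorProduct.add_tmul, map_add, hx, hy]
  | tmul g w => simp

theorem deltaOne_tmul (m : ℕ) (f : P K I) (α : ⋀[K]^(m + 1) (WDual K I)) :
    deltaOne K I m (f ⊗ₜ[K] α) = -TensorProduct.map LinearMap.id
      ((interiorMul K (W K I) m).flip α) (dFun K I f) :=
  congrArg Neg.neg (map_lift_assoc_tmul (interiorMul K (W K I) m) (dFun K I f) α)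

theorem current_map [Nonempty I] (m : ℕ) (q : W K I →ₗ[K] ⋀[K]^m (WDual K I))
    (x : P K I ⊗[K] W K I) (g : P K I) (ω : ⋀[K]^m (W K I)) :
    current K I m (TensorProduct.map LinearMap.id q x) (g ⊗ₜ[K] ω) =
      integral K I (g * coeffMap ((extPairing K I m).flip ω ∘ₗ q) x) := by
  have h : (current K I m).flip (g ⊗ₜ[K] ω) ∘ₗ TensorProduct.map LinearMap.id q =
      integral K I ∘ₗ LinearMap.mulLeft K g ∘ₗ coeffMap ((extPairing K I m).flip ω ∘ₗ q) := by
    refine TensorProduct.ext' fun f w => ?_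
    change current K I m (f ⊗ₜ[K] q w) (g ⊗ₜ[K] ω) =
      integral K I (g * extPairing K I m (q w) ω • f)
    rw [current_tmul, mul_smul_comm, LinearMap.map_smul, smul_eq_mul, mul_comm g]
  exact LinearMap.congr_fun h x

theorem current_deltaOne [Nonempty I] (m : ℕ) (f g : P K I) (α : ⋀[K]^(m + 1) (WDual K I))
    (ω : ⋀[K]^m (W K I)) :
    current K I m (deltaOne K I m (f ⊗ₜ[K] α)) (g ⊗ₜ[K] ω) = -integral K I
      (g * coeffMap ((extPairing K I m).flip ω ∘ₗ (interiorMul K (W K I) m).flip α)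
        (dFun K I f)) := by
  rw [deltaOne_tmul, LinearMap.map_neg, LinearMap.neg_apply, current_map]

theorem current_wedgeForm [Nonempty I] (m : ℕ) (f : P K I) (x : P K I ⊗[K] W K I)
    (α : ⋀[K]^(m + 1) (WDual K I)) (ω : ⋀[K]^m (W K I)) :
    (-1 : K) ^ (m + 1) * current K I (m + 1) (f ⊗ₜ[K] α) (wedgeForm m ω x) = integral K I
      (f * coeffMap ((extPairing K I m).flip ω ∘ₗ (interiorMul K (W K I) m).flip α) x) := by
  have h : (-1 : K) ^ (m + 1) • (current K I (m + 1) (f ⊗ₜ[K] α) ∘ₗ wedgeForm m ω) =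
      integral K I ∘ₗ LinearMap.mulLeft K f ∘ₗ
        coeffMap ((extPairing K I m).flip ω ∘ₗ (interiorMul K (W K I) m).flip α) := by
    refine TensorProduct.ext' fun g w => ?_
    change (-1 : K) ^ (m + 1) * current K I (m + 1) (f ⊗ₜ[K] α)
      (g ⊗ₜ[K] wedge K (W K I) m w ω) =
        integral K I (f * extPairing K I m (interiorMul K (W K I) m w α) ω • g)
    rw [current_tmul, mul_smul_comm, LinearMap.map_smul, smul_eq_mul, ← mul_assoc,
      neg_one_pow_mul_extPairing_wedge]
  exact LinearMap.congr_fun h x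

/-- The linear form `c(w) = ⟨w ⌟ α, ω⟩` here is the one in `current_deltaOne`, so the two formulas
are the two halves of the Leibniz rule for `c(d(f g))`. -/
theorem current_deRham [Nonempty I] (m : ℕ) (f g : P K I) (α : ⋀[K]^(m + 1) (WDual K I))
    (ω : ⋀[K]^m (W K I)) :
    (-1 : K) ^ (m + 1) * current K I (m + 1) (f ⊗ₜ[K] α) (deRham K I m (g ⊗ₜ[K] ω)) =
      integral K I
      (f * coeffMap ((extPairing K I m).flip ω ∘ₗ (interiorMul K (W K I) m).flip α)
        (dFun K I g)) := by
  rw [deRham_tmul, current_wedgeForm]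

theorem ker_wPullback_le {σ : I → J} {j : J} (hj : Set.range σ = {j}ᶜ) :
    LinearMap.ker (wPullback K σ) ≤ Submodule.span K {dt K j} := by
  classical
  intro w hw
  obtain ⟨w, rfl⟩ := Submodule.mkQ_surjective _ w
  rw [LinearMap.mem_ker, wPullback_mkQ, Submodule.mkQ_apply, Submodule.Quotient.mk_eq_zero,
    Submodule.mem_span_singleton] at hw
  obtain ⟨c, hc⟩ := hw
  -- Away from `j` the function `w` is the constant `c`, so `w - c • 1` is supported at `j` with
  -- value `w j - c`.
  refine Submodule.mem_span_singleton.2 ⟨w j - c, ?_⟩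
  rw [dt_eq, ← map_smul, ← sub_eq_zero, ← map_sub, Submodule.mkQ_apply,
    Submodule.Quotient.mk_eq_zero, Submodule.mem_span_singleton]
  refine ⟨-c, ?_⟩
  ext k
  by_cases hk : k = j
  · subst hk
    simp
  · obtain ⟨i, rfl⟩ : k ∈ Set.range σ := by
      rw [hj]
      exact hk
    have := congrFun hc i
    simp only [Pi.smul_apply, Pi.one_apply, smul_eq_mul, mul_one, Function.comp_apply] at this
    simp [hk, this]

theorem extPush_injective {σ : I → J} (hσ : Function.Injective σ) (m : ℕ) :
    Function.Injective (extPush K σ m) := by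
  refine exteriorPower.map_injective_field ?_
  exact LinearMap.dualMap_injective_of_surjective (wPullback_surjective hσ)

/-- The kernel of restriction to the facet lies in the line spanned by `dt_j`, so linear forms that
vanish on `dt_j` come from the facet. This makes the left inverse in `deltaTwo` a true inverse on
the elements to which it is applied. -/
theorem contract_mem_range_extPush {σ : I → J} {j : J} (hj : Set.range σ = {j}ᶜ) (m : ℕ)
    (α : ⋀[K]^(m + 1) (WDual K J)) :
    contract K m (Module.Dual.eval K (W K J) (dt K j)) α ∈ LinearMap.range (extPush K σ m) := by
  refine contract_mem_range_map m (Module.Dual.eval K (W K J) (dt K j)) ?_ α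
  rw [LinearMap.range_dualMap_eq_dualAnnihilator_ker]
  intro a ha
  rw [Submodule.mem_dualAnnihilator]
  intro w hw
  obtain ⟨c, rfl⟩ := Submodule.mem_span_singleton.1 (ker_wPullback_le hj hw)
  rw [LinearMap.map_smul, show a (dt K j) = 0 from ha, smul_zero]

theorem apply_leftInverse_of_mem_range {V U : Type*} [AddCommGroup V] [Module K V] [AddCommGroup U]
    [Module K U] {f : V →ₗ[K] U} (hf : Function.Injective f) {x : U}
    (hx : x ∈ LinearMap.range f) : f (f.leftInverse x) = x := by
  obtain ⟨y, rfl⟩ := hx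
  rw [LinearMap.leftInverse_apply_of_inj (LinearMap.ker_eq_bot.2 hf)]

theorem interiorMul_mem_range_extPush {σ : I → J} {j : J} (hj : Set.range σ = {j}ᶜ) (m : ℕ)
    (α : ⋀[K]^(m + 1) (WDual K J)) :
    interiorMul K (W K J) m (dt K j) α ∈ LinearMap.range (extPush K σ m) := by
  rw [interiorMul_eq]
  exact neg_mem (contract_mem_range_extPush hj m α)

theorem extPush_leftInverse_interiorMul {σ : I → J} (hσ : Function.Injective σ) {j : J}
    (hj : Set.range σ = {j}ᶜ) (m : ℕ) (α : ⋀[K]^(m + 1) (WDual K J)) :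
    extPush K σ m ((extPush K σ m).leftInverse (interiorMul K (W K J) m (dt K j) α)) =
      interiorMul K (W K J) m (dt K j) α :=
  apply_leftInverse_of_mem_range (f := extPush K σ m)
    (x := interiorMul K (W K J) m (dt K j) α) (extPush_injective hσ m)
    (interiorMul_mem_range_extPush hj m α)

end Forms

/-! ### Stokes' theorem for currents; `δ² = 0` and functoriality -/

section Differential

set_option linter.unusedSectionVars false
set_option maxHeartbeats 2000000

variable {K : Type u} [Field K] [CharZero K] {I : Type v} [Fintype I]

theorem eraseIncl_injective {J : Finset I} (j : J) : Function.Injective (eraseIncl j) :=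
  fun _ _ h => Subtype.ext (congrArg (fun k : J => (k : I)) h)

theorem range_eraseIncl {J : Finset I} (j : J) : Set.range (eraseIncl j) = {j}ᶜ := by
  classical
  ext k
  rw [Set.mem_compl_singleton_iff]
  constructor
  · rintro ⟨l, rfl⟩ h
    exact Finset.ne_of_mem_erase l.2 (congrArg (fun k : J => (k : I)) h)
  · intro h
    exact ⟨⟨k, Finset.mem_erase.2 ⟨fun h' => h (Subtype.ext h'), k.2⟩⟩, rfl⟩

theorem deltaTwo_tmul {J : Finset I} (j : J) (m : ℕ) (f : P K J)
    (α : ⋀[K]^(m + 1) (WDual K J)) :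
    deltaTwo K j m (f ⊗ₜ[K] α) = -(pPullback K (eraseIncl j) f ⊗ₜ[K]
      (extPush K (eraseIncl j) m).leftInverse (interiorMul K (W K J) m (dt K j) α)) :=
  rfl

open scoped Classical in
theorem current_deltaTwo {J : Finset I} (j : J) [Nonempty (J.erase (j : I) : Finset I)] (m : ℕ)
    (f g : P K J) (α : ⋀[K]^(m + 1) (WDual K J)) (ω : ⋀[K]^m (W K J)) :
    current K (J.erase (j : I) : Finset I) m (deltaTwo K j m (f ⊗ₜ[K] α))
        (omPullback K (eraseIncl j) m (g ⊗ₜ[K] ω)) =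
      -(extPairing K J m (interiorMul K (W K J) m (dt K j) α) ω *
        integral K (J.erase (j : I) : Finset I) (pPullback K (eraseIncl j) (f * g))) := by
  rw [deltaTwo_tmul, LinearMap.map_neg, LinearMap.neg_apply, omPullback_tmul, current_tmul,
    ← extPairing_extPush, extPush_leftInverse_interiorMul (eraseIncl_injective j)
      (range_eraseIncl j), map_mul (pPullback K (eraseIncl j))]

theorem subsingleton_W [Subsingleton I] : Subsingleton (W K I) := by
  refine Submodule.Quotient.subsingleton_iff.2 (eq_top_iff.2 fun w _ => ?_)
  rcases isEmpty_or_nonempty I with h | ⟨⟨i⟩⟩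
  · rw [Subsingleton.elim w 0]
    exact Submodule.zero_mem _
  · refine Submodule.mem_span_singleton.2 ⟨w i, ?_⟩
    ext k
    rw [Subsingleton.elim k i]
    simp

open scoped Classical in
-- Integrating `c(d(f g)) = f c(dg) + g c(df)` and applying `integral_coeffMap_dFun` to `f g` gives
-- the facet terms. If `J` has a single element, then `W_J = 0` and there is no nonempty facet, so
-- every term is zero.
theorem current_stokes_tmul (J : NESub I) (m : ℕ) (f g : P K J.1)
    (α : ⋀[K]^(m + 1) (WDual K J.1)) (ω : ⋀[K]^m (W K J.1)) :
    (-1 : K) ^ (m + 1) * current K J.1 (m + 1) (f ⊗ₜ[K] α) (deRham K J.1 m (g ⊗ₜ[K] ω)) =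
      current K J.1 m (deltaOne K J.1 m (f ⊗ₜ[K] α)) (g ⊗ₜ[K] ω) +
      ∑ j : J.1, if h : (J.1.erase (j : I)).Nonempty then
        have := h.to_subtype
        current K (J.1.erase (j : I) : Finset I) m (deltaTwo K j m (f ⊗ₜ[K] α))
        (omPullback K (eraseIncl j) m (g ⊗ₜ[K] ω)) else 0 := by
  rw [current_deRham, current_deltaOne]
  set c := (extPairing K J.1 m).flip ω ∘ₗ (interiorMul K (W K J.1) m).flip α with hc
  have hleib := congrArg (integral K J.1) (dFun_mul f g c)
  rw [LinearMap.map_add] at hleib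
  by_cases hJ : 1 < Fintype.card J.1
  · have hne (j : J.1) : (J.1.erase (j : I)).Nonempty := by
      rw [← Finset.card_pos, Finset.card_erase_of_mem j.2]
      rw [Fintype.card_coe] at hJ
      omega
    have (j : J.1) : Nonempty (J.1.erase (j : I) : Finset I) := (hne j).to_subtype
    have hst := integral_coeffMap_dFun hJ c (F := fun j : J.1 => (J.1.erase (j : I) : Finset I))
      (fun j => eraseIncl j) eraseIncl_injective range_eraseIncl (f * g)
    have hsum : (∑ j : J.1, if h : (J.1.erase (j : I)).Nonempty then
        have := h.to_subtype
        current K (J.1.erase (j : I) : Finset I) m (deltaTwo K j m (f ⊗ₜ[K] α))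
        (omPullback K (eraseIncl j) m (g ⊗ₜ[K] ω)) else 0) =
        -∑ j : J.1, c (dt K j) * integral K (J.1.erase (j : I) : Finset I)
          (pPullback K (eraseIncl j) (f * g)) := by
      rw [← Finset.sum_neg_distrib]
      refine Finset.sum_congr rfl fun j _ => ?_
      rw [dif_pos (hne j), current_deltaTwo]
      rfl
    rw [hsum, ← hst, hleib]
    ring
  · have hle : Fintype.card J.1 ≤ 1 := not_lt.1 hJ
    have : Subsingleton J.1 := Fintype.card_le_one_iff_subsingleton.1 hle
    have := subsingleton_W (K := K) (I := J.1)
    have hc0 : c = 0 := LinearMap.ext fun w => by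
      rw [Subsingleton.elim w 0, LinearMap.map_zero, LinearMap.map_zero]
    have hz (x : P K J.1 ⊗[K] W K J.1) : coeffMap c x = 0 := by
      rw [hc0, coeffMap, TensorProduct.map_zero_right, LinearMap.comp_zero, LinearMap.zero_apply]
    have hsum : (∑ j : J.1, if h : (J.1.erase (j : I)).Nonempty then
        have := h.to_subtype
        current K (J.1.erase (j : I) : Finset I) m (deltaTwo K j m (f ⊗ₜ[K] α))
        (omPullback K (eraseIncl j) m (g ⊗ₜ[K] ω)) else 0) = 0 := by
      refine Finset.sum_eq_zero fun j _ => dif_neg ?_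
      rw [← Finset.card_pos, Finset.card_erase_of_mem j.2]
      rw [Fintype.card_coe] at hle
      omega
    rw [hsum, hz, hz, mul_zero, mul_zero, LinearMap.map_zero, neg_zero, add_zero]

open scoped Classical in
theorem current_stokes (J : NESub I) (m : ℕ) (x : Tht K J.1 (m + 1)) (y : Om K J.1 m) :
    (-1 : K) ^ (m + 1) * current K J.1 (m + 1) x (deRham K J.1 m y) =
      current K J.1 m (deltaOne K J.1 m x) y +
      ∑ j : J.1, if h : (J.1.erase (j : I)).Nonempty then
        have := h.to_subtype
        current K (J.1.erase (j : I) : Finset I) m (deltaTwo K j m x)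
        (omPullback K (eraseIncl j) m y) else 0 := by
  -- The right-hand side is packaged as a linear map so that the identity can be checked on pure
  -- tensors in both arguments.
  let B : Tht K J.1 (m + 1) →ₗ[K] HatPhi K J.1 m :=
    current K J.1 m ∘ₗ deltaOne K J.1 m +
      ∑ j : J.1, if h : (J.1.erase (j : I)).Nonempty then
        have := h.to_subtype
        (omPullback K (eraseIncl j) m).dualMap ∘ₗ current K (J.1.erase (j : I) : Finset I) m ∘ₗ
          deltaTwo K j m
        else 0
  have hB (x : Tht K J.1 (m + 1)) (y : Om K J.1 m) : B x y =
      current K J.1 m (deltaOne K J.1 m x) y +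
      ∑ j : J.1, if h : (J.1.erase (j : I)).Nonempty then
        have := h.to_subtype
        current K (J.1.erase (j : I) : Finset I) m (deltaTwo K j m x)
        (omPullback K (eraseIncl j) m y) else 0 := by
    simp only [B]
    rw [LinearMap.add_apply, LinearMap.add_apply, LinearMap.sum_apply, LinearMap.sum_apply]
    congr 1
    refine Finset.sum_congr rfl fun j _ => ?_
    split_ifs <;> rfl
  have key : (hatDelta K J.1 m) ∘ₗ current K J.1 (m + 1) = B := by
    refine TensorProduct.ext' fun f α => TensorProduct.ext' fun g ω => ?_
    rw [hB, ← current_stokes_tmul]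
    rfl
  rw [← hB, ← key]
  rfl

open scoped Classical in
theorem delta_incl (J : NESub I) (m : ℕ) (x : Tht K J.1 (m + 1)) :
    delta K I m (incl K J (m + 1) x) = incl K J m (deltaOne K J.1 m x) +
      ∑ j : J.1, if h : (J.1.erase (j : I)).Nonempty then
        incl K ⟨J.1.erase (j : I), h⟩ m (deltaTwo K j m x) else 0 := by
  rw [delta, Phi.desc_incl, LinearMap.add_apply, LinearMap.sum_apply]
  congr 1
  refine Finset.sum_congr rfl fun j _ => ?_
  split_ifs <;> rfl

theorem xi_comp_delta (m : ℕ) :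
    xi K I m ∘ₗ delta K I m = hatDelta K I m ∘ₗ xi K I (m + 1) := by
  classical
  refine Phi.linearMap_ext fun J x => LinearMap.ext fun ω => ?_
  have h1 : (hatDelta K I m ∘ₗ xi K I (m + 1)) (incl K J (m + 1) x) ω =
      (-1 : K) ^ (m + 1) * xi K I (m + 1) (incl K J (m + 1) x) (deRham K I m ω) := rfl
  rw [h1, xi_incl_apply, ← deRham_omPullback, current_stokes, LinearMap.comp_apply, delta_incl,
    LinearMap.map_add, LinearMap.add_apply, xi_incl_apply, map_sum, LinearMap.sum_apply]
  congr 1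
  refine Finset.sum_congr rfl fun j _ => ?_
  split_ifs with h
  · rw [xi_incl_apply]
    exact congrArg _ (omPullback_comp (eraseIncl j) (fun a : J.1 => (a : I)) m ω)
  · rw [LinearMap.map_zero, LinearMap.zero_apply]

/-- Injectivity of `xi` reduces this to the dual complex. The same method gives `delta_comp_push`,
`push_id` and `push_comp`, avoiding any computation with the components of `delta` and `push`. -/
theorem delta_comp_delta (m : ℕ) : delta K I m ∘ₗ delta K I (m + 1) = 0 := by
  refine LinearMap.ext fun x => xi_injective m ?_
  have h1 (m : ℕ) (x : Phi K I (m + 1)) :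
      xi K I m (delta K I m x) = hatDelta K I m (xi K I (m + 1) x) :=
    LinearMap.congr_fun (xi_comp_delta m) x
  rw [LinearMap.comp_apply, h1, h1, LinearMap.zero_apply, LinearMap.map_zero]
  exact LinearMap.congr_fun (hatDelta_comp_hatDelta m) _

variable {J L : Type v} [Fintype J] [Fintype L]

theorem xi_push_apply (σ : I → J) (m : ℕ) (x : Phi K I m) :
    xi K J m (push K σ m x) = (omPullback K σ m).dualMap (xi K I m x) :=
  LinearMap.congr_fun (xi_push σ m) x

theorem xi_delta_apply (m : ℕ) (x : Phi K I (m + 1)) :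
    xi K I m (delta K I m x) = hatDelta K I m (xi K I (m + 1) x) :=
  LinearMap.congr_fun (xi_comp_delta m) x

theorem delta_comp_push (σ : I → J) (m : ℕ) :
    delta K J m ∘ₗ push K σ (m + 1) = push K σ m ∘ₗ delta K I m := by
  refine LinearMap.ext fun x => xi_injective m ?_
  rw [LinearMap.comp_apply, LinearMap.comp_apply, xi_delta_apply, xi_push_apply, xi_push_apply,
    xi_delta_apply, hatDelta_dualMap_omPullback]

theorem push_id (m : ℕ) : push K (id : I → I) m = LinearMap.id := by
  refine LinearMap.ext fun x => xi_injective m ?_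
  rw [xi_push_apply, LinearMap.id_apply]
  exact LinearMap.ext fun ω => congrArg (xi K I m x) (omPullback_id m ω)

theorem push_comp (σ : I → J) (τ : J → L) (m : ℕ) :
    push K (τ ∘ σ) m = push K τ m ∘ₗ push K σ m := by
  refine LinearMap.ext fun x => xi_injective m ?_
  rw [xi_push_apply, LinearMap.comp_apply, xi_push_apply, xi_push_apply]
  exact LinearMap.ext fun ω => congrArg (xi K I m x) (omPullback_comp σ τ m ω)

end Differential

/-! ### Fibre integration as a chain homotopy -/

section FibreHomotopy

set_option linter.unusedSectionVars false
set_option maxHeartbeats 2000000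

theorem contract_map {K V U : Type*} [Field K] [AddCommGroup V] [Module K V] [AddCommGroup U]
    [Module K U] (m : ℕ) (f : V →ₗ[K] U) (d : Module.Dual K U) (x : ⋀[K]^(m + 1) V) :
    contract K m d (exteriorPower.map (m + 1) f x) =
      exteriorPower.map m f (contract K m (d ∘ₗ f) x) := by
  have h : contract K m d ∘ₗ exteriorPower.map (m + 1) f =
      exteriorPower.map m f ∘ₗ contract K m (d ∘ₗ f) := by
    refine exteriorPower.linearMap_ext ?_
    ext w
    simp only [LinearMap.compAlternatingMap_apply, LinearMap.comp_apply,
      exteriorPower.map_apply_ιMulti, contract_ιMulti, map_sum, map_smul]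
    rfl
  exact LinearMap.congr_fun h x

theorem exteriorPower_map_zero_eq {K V U : Type*} [Field K] [AddCommGroup V] [Module K V]
    [AddCommGroup U] [Module K U] (f g : V →ₗ[K] U) (x : ⋀[K]^0 V) :
    exteriorPower.map 0 f x = exteriorPower.map 0 g x := by
  have h : exteriorPower.map 0 f = exteriorPower.map 0 g := by
    refine exteriorPower.linearMap_ext ?_
    ext w
    simp only [LinearMap.compAlternatingMap_apply, exteriorPower.map_apply_ιMulti]
    congr 1
  exact LinearMap.congr_fun h x

variable {K : Type u} [Field K] {I : Type v} [Fintype I]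

variable (K) in
/-- The tangent vector `∂_none - ∂_y` along the fibres of `collapse y`, as a linear form on
`W_{Option I}`. -/
def fibreVector (y : I) : WDual K (Option I) :=
  (Submodule.span K {(1 : Option I → K)}).liftQ
    ((LinearMap.proj none : (Option I → K) →ₗ[K] K) - LinearMap.proj (some y)) (by
      rw [Submodule.span_le, Set.singleton_subset_iff, SetLike.mem_coe, LinearMap.mem_ker,
        LinearMap.sub_apply]
      exact sub_self (1 : K))

theorem fibreVector_mkQ (y : I) (w : Option I → K) :
    fibreVector K y ((Submodule.span K {(1 : Option I → K)}).mkQ w) = w none - w (some y) :=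
  rfl

theorem fibreVector_dt_none (y : I) : fibreVector K y (dt K none) = 1 := by
  classical
  rw [dt_eq, fibreVector_mkQ]
  simp

theorem fibreVector_dt_self (y : I) : fibreVector K y (dt K (some y)) = -1 := by
  classical
  rw [dt_eq, fibreVector_mkQ]
  simp

theorem fibreVector_dt_of_ne {y i : I} (h : i ≠ y) : fibreVector K y (dt K (some i)) = 0 := by
  classical
  rw [dt_eq, fibreVector_mkQ]
  simp [h.symm]

/-- The two facet maps differ only at `y`, so their pullbacks differ by a rank-one map. Thus
`exteriorPower_map_add_smul` compares them on forms of all degrees. -/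
theorem wPullback_splitNone (y : I) (w : W K (Option I)) :
    wPullback K (splitNone y) w = wPullback K some w + fibreVector K y w • dt K y := by
  classical
  obtain ⟨w, rfl⟩ := Submodule.mkQ_surjective _ w
  rw [wPullback_mkQ, wPullback_mkQ, fibreVector_mkQ, dt_eq, ← map_smul, ← map_add]
  congr 1
  ext i
  by_cases hi : i = y
  · subst hi
    simp [splitNone_self]
  · simp [splitNone_of_ne hi, hi]

theorem wPullback_some_dt_none : wPullback K (some : I → Option I) (dt K none) = 0 := by
  classical
  rw [wPullback_dt]
  simp

theorem wPullback_some_dt_some (i : I) : wPullback K (some : I → Option I) (dt K (some i)) =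
    dt K i := by
  classical
  rw [wPullback_dt, Finset.sum_eq_single_of_mem i (by simp)]
  intro j hj hji
  exact absurd (by simpa using hj) hji

variable [CharZero K]

variable (K) in
/-- Integration of forms along the fibres of `collapse y : Option I → I`. -/
def fibreIntegral (y : I) (m : ℕ) : Om K (Option I) (m + 1) →ₗ[K] Om K I m :=
  TensorProduct.map (pPush K (collapse_surjective y))
    (exteriorPower.map m (wPullback K some) ∘ₗ contract K m (fibreVector K y))

theorem fibreIntegral_tmul (y : I) (m : ℕ) (g : P K (Option I)) (ω : ⋀[K]^(m + 1)
    (W K (Option I))) :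
    fibreIntegral K y m (g ⊗ₜ[K] ω) = pPush K (collapse_surjective y) g ⊗ₜ[K]
      exteriorPower.map m (wPullback K some) (contract K m (fibreVector K y) ω) :=
  rfl

/-- The fundamental theorem of calculus on each fibre: the derivative along the fibre integrates to
the difference of the end-point values. -/
theorem sum_tmul_fibreVector {M : Type*} [AddCommGroup M] [Module K M] (y : I)
    (p : MvPolynomial (Option I) K) (a : M) :
    ∑ k : Option I, P.mk K I (polyPush K (collapse y) (pderiv k p)) ⊗ₜ[K]
        (fibreVector K y (dt K k) • a) =
      P.mk K I (polyPullback K (splitNone y) p) ⊗ₜ[K] a -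
        P.mk K I (polyPullback K some p) ⊗ₜ[K] a := by
  rw [Fintype.sum_option, Fintype.sum_eq_single y, fibreVector_dt_none, fibreVector_dt_self,
    one_smul, neg_one_smul, TensorProduct.tmul_neg, polyPush_pderiv_none,
    polyPush_pderiv_some_self, map_sub, map_sub, TensorProduct.sub_tmul, TensorProduct.sub_tmul]
  · abel
  · intro i hi
    rw [fibreVector_dt_of_ne hi, zero_smul, TensorProduct.tmul_zero]

theorem sum_tmul_some {M : Type*} [AddCommGroup M] [Module K M] (y : I)
    (p : MvPolynomial (Option I) K) (a : I → M) :
    ∑ i : I, P.mk K I (polyPush K (collapse y) (pderiv (some i) p)) ⊗ₜ[K] a i =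
      ∑ i : I, P.mk K I (pderiv i (polyPush K (collapse y) p)) ⊗ₜ[K] a i -
        P.mk K I (polyPullback K (splitNone y) p) ⊗ₜ[K] a y := by
  classical
  rw [← Finset.add_sum_erase _ _ (Finset.mem_univ y),
    ← Finset.add_sum_erase Finset.univ
      (fun i => P.mk K I (pderiv i (polyPush K (collapse y) p)) ⊗ₜ[K] a i) (Finset.mem_univ y),
    Finset.sum_congr rfl fun i hi => by
      rw [polyPush_pderiv_some_of_ne (Finset.ne_of_mem_erase hi)],
    polyPush_pderiv_some_self, map_sub, TensorProduct.sub_tmul]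
  abel

theorem fibreIntegral_zero_deRham (y : I) (x : Om K (Option I) 0) :
    fibreIntegral K y 0 (deRham K (Option I) 0 x) =
      omPullback K (splitNone y) 0 x - omPullback K some 0 x := by
  have h : fibreIntegral K y 0 ∘ₗ deRham K (Option I) 0 =
      omPullback K (splitNone y) 0 - omPullback K some 0 := by
    refine TensorProduct.ext' fun g ω => ?_
    obtain ⟨p, rfl⟩ := P.mk_surjective K g
    rw [LinearMap.comp_apply, LinearMap.sub_apply, deRham_mk_tmul, map_sum, omPullback_tmul,
      omPullback_tmul, exteriorPower_map_zero_eq (wPullback K (splitNone y)) (wPullback K some),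
      pPullback_mk, pPullback_mk, ← sum_tmul_fibreVector]
    refine Finset.sum_congr rfl fun k _ => ?_
    rw [fibreIntegral_tmul, contract_zero_wedge, pPush_mk, LinearMap.map_smul]
  exact LinearMap.congr_fun h x

/-- Contracting `dt_k ∧ ω` along the fibre gives two sums. The first is evaluated by
`sum_tmul_fibreVector` and yields the difference of end-point values with coefficient `some^* ω`.
The second is differentiation under the integral: it cancels `d` of the fibre integral up to a
boundary term `dt_y ∧ θ`, which is the correction that turns `some^* ω` into `(splitNone y)^* ω`. -/
theorem fibreIntegral_deRham (y : I) (m : ℕ) (x : Om K (Option I) (m + 1)) :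
    fibreIntegral K y (m + 1) (deRham K (Option I) (m + 1) x) +
        deRham K I m (fibreIntegral K y m x) =
      omPullback K (splitNone y) (m + 1) x - omPullback K some (m + 1) x := by
  have h : fibreIntegral K y (m + 1) ∘ₗ deRham K (Option I) (m + 1) +
      deRham K I m ∘ₗ fibreIntegral K y m =
      omPullback K (splitNone y) (m + 1) - omPullback K some (m + 1) := by
    refine TensorProduct.ext' fun g ω => ?_
    obtain ⟨p, rfl⟩ := P.mk_surjective K g
    rw [LinearMap.add_apply, LinearMap.comp_apply, LinearMap.comp_apply, LinearMap.sub_apply,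
      deRham_mk_tmul, map_sum, omPullback_tmul, omPullback_tmul,
      exteriorPower_map_add_smul (wPullback_splitNone y), pPullback_mk, pPullback_mk,
      fibreIntegral_tmul, pPush_mk, deRham_mk_tmul]
    set ω' := exteriorPower.map (m + 1) (wPullback K some) ω
    set θ := exteriorPower.map m (wPullback K some) (contract K m (fibreVector K y) ω)
    have h1 (k : Option I) : fibreIntegral K y (m + 1) (P.mk K (Option I) (pderiv k p) ⊗ₜ[K]
        wedge K (W K (Option I)) (m + 1) (dt K k) ω) =
        P.mk K I (polyPush K (collapse y) (pderiv k p)) ⊗ₜ[K] (fibreVector K y (dt K k) • ω') -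
        P.mk K I (polyPush K (collapse y) (pderiv k p)) ⊗ₜ[K]
          wedge K (W K I) m (wPullback K some (dt K k)) θ := by
      rw [fibreIntegral_tmul, contract_wedge, LinearMap.map_sub, LinearMap.map_smul,
        exteriorPower_map_wedge, pPush_mk, TensorProduct.tmul_sub]
    rw [Finset.sum_congr rfl fun k _ => h1 k, Finset.sum_sub_distrib, sum_tmul_fibreVector,
      Fintype.sum_option, wPullback_some_dt_none, LinearMap.map_zero, LinearMap.zero_apply,
      TensorProduct.tmul_zero, zero_add]
    simp only [wPullback_some_dt_some]
    rw [sum_tmul_some y p fun i => wedge K (W K I) m (dt K i) θ, TensorProduct.tmul_add]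
    abel
  exact LinearMap.congr_fun h x

variable {J : Type v} [Fintype J]

theorem fibreVector_comp_wPullback {σ : J → I} (y : J) :
    fibreVector K y ∘ₗ wPullback K (Option.map σ) = fibreVector K (σ y) := by
  refine Submodule.linearMap_qext _ ?_
  rfl

theorem pPullback_pPush_collapse {σ : J → I} (hσ : Function.Injective σ) (y : J)
    (g : P K (Option I)) :
    pPullback K σ (pPush K (collapse_surjective (σ y)) g) =
      pPush K (collapse_surjective y) (pPullback K (Option.map σ) g) := by
  obtain ⟨p, rfl⟩ := P.mk_surjective K g
  rw [pPush_mk, pPullback_mk, pPullback_mk, pPush_mk, polyPullback_polyPush_collapse hσ]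

theorem omPullback_fibreIntegral {σ : J → I} (hσ : Function.Injective σ) (y : J) (m : ℕ)
    (x : Om K (Option I) (m + 1)) :
    omPullback K σ m (fibreIntegral K (σ y) m x) =
      fibreIntegral K y m (omPullback K (Option.map σ) (m + 1) x) := by
  have h : omPullback K σ m ∘ₗ fibreIntegral K (σ y) m =
      fibreIntegral K y m ∘ₗ omPullback K (Option.map σ) (m + 1) := by
    refine TensorProduct.ext' fun g ω => ?_
    rw [LinearMap.comp_apply, LinearMap.comp_apply, fibreIntegral_tmul, omPullback_tmul,
      omPullback_tmul, fibreIntegral_tmul, pPullback_pPush_collapse hσ, contract_map,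
      fibreVector_comp_wPullback, ← LinearMap.comp_apply (exteriorPower.map m _),
      ← LinearMap.comp_apply (exteriorPower.map m _), ← exteriorPower.map_comp,
      ← exteriorPower.map_comp, ← wPullback_comp, ← wPullback_comp]
    rfl
  exact LinearMap.congr_fun h x

theorem omPullback_fibreIntegral_of_notMem {σ : J → I} {y : I} (hy : y ∉ Set.range σ) (m : ℕ)
    (x : Om K (Option I) (m + 1)) : omPullback K σ m (fibreIntegral K y m x) = 0 := by
  have h : omPullback K σ m ∘ₗ fibreIntegral K y m = 0 := by
    refine TensorProduct.ext' fun g ω => ?_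
    obtain ⟨p, rfl⟩ := P.mk_surjective K g
    rw [LinearMap.comp_apply, fibreIntegral_tmul, omPullback_tmul, pPush_mk, pPullback_mk,
      polyPullback_polyPush_collapse_of_notMem hy, map_zero (P.mk K J), TensorProduct.zero_tmul,
      LinearMap.zero_apply]
  exact LinearMap.congr_fun h x

/-- The function part is pulled back along `collapse y`, by adjointness of `pPush`. The multivector
part exists because the pairing of exterior powers is perfect. -/
theorem dualMap_fibreIntegral_current [Nonempty I] (y : I) (m : ℕ) (α : Tht K I m) :
    ∃ β : Tht K (Option I) (m + 1),
      current K (Option I) (m + 1) β = (fibreIntegral K y m).dualMap (current K I m α) := by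
  induction α using TensorProduct.induction_on with
  | zero => exact ⟨0, by rw [LinearMap.map_zero, LinearMap.map_zero, LinearMap.map_zero]⟩
  | add α α' hα hα' =>
    obtain ⟨β, hβ⟩ := hα
    obtain ⟨β', hβ'⟩ := hα'
    exact ⟨β + β', by rw [LinearMap.map_add, LinearMap.map_add, LinearMap.map_add, hβ, hβ']⟩
  | tmul f a =>
    obtain ⟨b, hb⟩ := extPairing_surjective (m + 1) (extPairing K I m a ∘ₗ
      exteriorPower.map m (wPullback K some) ∘ₗ contract K m (fibreVector K y))
    refine ⟨pPullback K (collapse y) f ⊗ₜ[K] b, TensorProduct.ext' fun g ω => ?_⟩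
    rw [LinearMap.dualMap_apply, fibreIntegral_tmul, current_tmul, current_tmul, hb, mul_comm f,
      integral_pPush_mul, mul_comm g]
    rfl

variable (K) in
/-- The chain homotopy on forms for the map `I → I` which takes `y` to `x`. -/
def mergeHomotopy (x y : I) (m : ℕ) : Om K I (m + 1) →ₗ[K] Om K I m :=
  fibreIntegral K y m ∘ₗ omPullback K (collapse x) (m + 1)

/-- The map `I → I` which takes `y` to `x` and fixes all other points. -/
def merge (x y : I) : I → I := collapse x ∘ splitNone y

theorem mergeHomotopy_zero (x y : I) (ω : Om K I 0) :
    mergeHomotopy K x y 0 (deRham K I 0 ω) = omPullback K (merge x y) 0 ω - ω := by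
  rw [mergeHomotopy, LinearMap.comp_apply, ← deRham_omPullback, fibreIntegral_zero_deRham,
    ← omPullback_comp, ← omPullback_comp]
  congr 1
  -- `collapse x ∘ some` is the identity by definition.
  exact omPullback_id 0 ω

theorem mergeHomotopy_succ (x y : I) (m : ℕ) (ω : Om K I (m + 1)) :
    mergeHomotopy K x y (m + 1) (deRham K I (m + 1) ω) + deRham K I m (mergeHomotopy K x y m ω) =
      omPullback K (merge x y) (m + 1) ω - ω := by
  rw [mergeHomotopy, mergeHomotopy, LinearMap.comp_apply, LinearMap.comp_apply,
    ← deRham_omPullback, fibreIntegral_deRham, ← omPullback_comp, ← omPullback_comp]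
  congr 1
  exact omPullback_id (m + 1) ω

/-- On the component at `A`, restriction to `A` commutes with fibre integration if `y ∈ A`; the
result is a current on the simplex `Option A`, mapped to `I` with the extra vertex going to `x`. If
`y ∉ A`, the fibres over the face are degenerate and the functional is zero. -/
theorem dualMap_mergeHomotopy_mem_range (x y : I) (m : ℕ) (α : Phi K I m) :
    (mergeHomotopy K x y m).dualMap (xi K I m α) ∈ LinearMap.range (xi K I (m + 1)) := by
  suffices ∀ (A : NESub I) (a : Tht K A.1 m), (mergeHomotopy K x y m).dualMap
      (xi K I m (incl K A m a)) ∈ LinearMap.range (xi K I (m + 1)) by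
    have h0 : ((LinearMap.range (xi K I (m + 1))).mkQ ∘ₗ (mergeHomotopy K x y m).dualMap ∘ₗ
        xi K I m) = 0 := by
      refine Phi.linearMap_ext fun A a => ?_
      exact (Submodule.Quotient.mk_eq_zero _).2 (this A a)
    exact (Submodule.Quotient.mk_eq_zero _).1 (LinearMap.congr_fun h0 α)
  intro A a
  by_cases hy : y ∈ A.1
  · obtain ⟨β, hβ⟩ := dualMap_fibreIntegral_current (⟨y, hy⟩ : A.1) m a
    convert dualMap_current_mem_range
      (collapse x ∘ Option.map (fun a : A.1 => (a : I))) (m + 1) β using 1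
    refine LinearMap.ext fun ω => ?_
    rw [LinearMap.dualMap_apply, LinearMap.dualMap_apply, xi_incl_apply, hβ, mergeHomotopy,
      LinearMap.comp_apply, LinearMap.dualMap_apply, omPullback_comp]
    exact congrArg (current K A.1 m a) (omPullback_fibreIntegral (σ := fun a : A.1 => (a : I))
      Subtype.val_injective ⟨y, hy⟩ m _)
  · convert Submodule.zero_mem _
    refine LinearMap.ext fun ω => ?_
    rw [LinearMap.dualMap_apply, xi_incl_apply, mergeHomotopy, LinearMap.comp_apply,
      omPullback_fibreIntegral_of_notMem, LinearMap.map_zero, LinearMap.zero_apply]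
    rintro ⟨a, rfl⟩
    exact hy a.2

end FibreHomotopy

section HomotopicToId

set_option linter.unusedSectionVars false
set_option maxHeartbeats 2000000

/-! ### Self-maps of complexes which are chain homotopic to the identity -/

section Abstract

variable {K : Type*} [Field K]

theorem exists_lift_of_range_le {V U Q : Type*} [AddCommGroup V] [Module K V] [AddCommGroup U]
    [Module K U] [AddCommGroup Q] [Module K Q] {f : V →ₗ[K] U} (hf : Function.Injective f)
    (g : Q →ₗ[K] U) (h : ∀ q, g q ∈ LinearMap.range f) : ∃ s : Q →ₗ[K] V, ∀ q, f (s q) = g q := by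
  refine ⟨(LinearEquiv.ofInjective f hf).symm.toLinearMap ∘ₗ g.codRestrict _ h, fun q => ?_⟩
  have := (LinearEquiv.ofInjective f hf).apply_symm_apply (g.codRestrict _ h q)
  exact congrArg Subtype.val this

variable {F : ℕ → Type*} [∀ m, AddCommGroup (F m)] [∀ m, Module K (F m)]
  {δ : ∀ m, F (m + 1) →ₗ[K] F m}

/-- The endomorphism `p` of the complex `(F, δ)` is chain homotopic to the identity. -/
def HomotopicToId (δ : ∀ m, F (m + 1) →ₗ[K] F m) (p : ∀ m, F m →ₗ[K] F m) : Prop :=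
  ∃ s : ∀ m, F m →ₗ[K] F (m + 1), (∀ a, δ 0 (s 0 a) = a - p 0 a) ∧
    ∀ m a, δ (m + 1) (s (m + 1) a) + s m (δ m a) = a - p (m + 1) a

theorem HomotopicToId.id : HomotopicToId δ fun _ => LinearMap.id :=
  ⟨fun _ => 0, fun a => by simp, fun m a => by simp⟩

/-- From `1 - pq = (1 - p) + p (1 - q)` one reads off the homotopy `s + p t`. -/
theorem HomotopicToId.comp {p q : ∀ m, F m →ₗ[K] F m}
    (hc : ∀ m, δ m ∘ₗ p (m + 1) = p m ∘ₗ δ m)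
    (hp : HomotopicToId δ p) (hq : HomotopicToId δ q) :
    HomotopicToId δ fun m => p m ∘ₗ q m := by
  obtain ⟨s, hs0, hs⟩ := hp
  obtain ⟨t, ht0, ht⟩ := hq
  have hc' (m : ℕ) (a : F (m + 1)) : δ m (p (m + 1) a) = p m (δ m a) :=
    LinearMap.congr_fun (hc m) a
  refine ⟨fun m => s m + p (m + 1) ∘ₗ t m, fun a => ?_, fun m a => ?_⟩
  · rw [LinearMap.add_apply, map_add, LinearMap.comp_apply, hc', hs0, ht0, map_sub,
      LinearMap.comp_apply]
    abel
  · have h1 := congrArg (p (m + 1)) (ht m a)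
    rw [map_add, map_sub] at h1
    rw [LinearMap.add_apply, map_add, LinearMap.comp_apply, hc', LinearMap.comp_apply,
      LinearMap.add_apply, LinearMap.comp_apply]
    calc _ = (δ (m + 1) (s (m + 1) a) + s m (δ m a)) +
        (p (m + 1) (δ (m + 1) (t (m + 1) a)) + p (m + 1) (t m (δ m a))) := by abel
      _ = _ := by
        rw [hs, h1]
        abel

variable {Ω : ℕ → Type*} [∀ m, AddCommGroup (Ω m)] [∀ m, Module K (Ω m)]

/-- A chain homotopy on a cochain complex `Ω` induces one on every subcomplex of the dual complex
which is preserved by the dual of the homotopy. -/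
theorem homotopicToId_of_dual {d : ∀ m, Ω m →ₗ[K] Ω (m + 1)} {p : ∀ m, F m →ₗ[K] F m}
    {r : ∀ m, Ω m →ₗ[K] Ω m} {h : ∀ m, Ω (m + 1) →ₗ[K] Ω m}
    {ξ : ∀ m, F m →ₗ[K] Module.Dual K (Ω m)} (hξ : ∀ m, Function.Injective (ξ m))
    (hδ : ∀ m a ω, ξ m (δ m a) ω = (-1 : K) ^ (m + 1) * ξ (m + 1) a (d m ω))
    (hp : ∀ m a ω, ξ m (p m a) ω = ξ m a (r m ω)) (h0 : ∀ ω, h 0 (d 0 ω) = r 0 ω - ω)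
    (hh : ∀ m ω, h (m + 1) (d (m + 1) ω) + d m (h m ω) = r (m + 1) ω - ω)
    (hr : ∀ m a, (h m).dualMap (ξ m a) ∈ LinearMap.range (ξ (m + 1))) :
    HomotopicToId δ p := by
  choose t ht using fun m =>
    exists_lift_of_range_le (hξ (m + 1)) ((h m).dualMap ∘ₗ ξ m) (hr m)
  have ht' (m : ℕ) (a : F m) (ω : Ω (m + 1)) : ξ (m + 1) (t m a) ω = ξ m a (h m ω) :=
    LinearMap.congr_fun (ht m a) ω
  -- The sign `(-1)^m` compensates the sign `(-1)^(m+1)` in `hδ`. Together they also turn `r - 1`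
  -- into `1 - p`.
  refine ⟨fun m => (-1 : K) ^ m • t m, fun a => hξ 0 (LinearMap.ext fun ω => ?_),
    fun m a => hξ (m + 1) (LinearMap.ext fun ω => ?_)⟩
  · rw [LinearMap.smul_apply, pow_zero, one_smul, hδ, ht', h0, map_sub, map_sub,
      LinearMap.sub_apply, hp]
    ring
  · have h1 := congrArg (ξ (m + 1) a) (hh m ω)
    rw [map_add, map_sub] at h1
    simp only [LinearMap.smul_apply, map_add, map_smul, map_sub, LinearMap.add_apply, hδ, ht',
      LinearMap.sub_apply, hp, smul_eq_mul]
    have h2 : ((-1 : K) ^ m) * (-1) ^ m = 1 := by rw [← mul_pow, neg_one_mul, neg_neg, one_pow]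
    rw [pow_succ, pow_succ]
    linear_combination -h1 - (ξ (m + 1) a (h (m + 1) (d (m + 1) ω)) +
      ξ (m + 1) a (d m (h m ω))) * h2

end Abstract

variable {K : Type u} [Field K] [CharZero K] {I : Type v} [Fintype I]

theorem homotopicToId_merge (x y : I) : HomotopicToId (F := Phi K I) (delta K I)
    (push K (merge x y)) :=
  homotopicToId_of_dual (F := Phi K I) (Ω := Om K I) (d := deRham K I)
    (r := omPullback K (merge x y))
    (h := mergeHomotopy K x y) (ξ := xi K I) xi_injective
    (fun m a ω => LinearMap.congr_fun (xi_delta_apply m a) ω)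
    (fun m a ω => LinearMap.congr_fun (xi_push_apply (merge x y) m a) ω)
    (mergeHomotopy_zero x y) (mergeHomotopy_succ x y) (dualMap_mergeHomotopy_mem_range x y)

theorem homotopicToId_push_id : HomotopicToId (F := Phi K I) (delta K I) (push K (id : I → I)) := by
  have h : push K (id : I → I) = fun m => LinearMap.id := funext push_id
  rw [h]
  exact HomotopicToId.id

theorem HomotopicToId.push_comp {σ τ : I → I} (hσ : HomotopicToId (F := Phi K I) (delta K I)
    (push K σ))
    (hτ : HomotopicToId (F := Phi K I) (delta K I) (push K τ)) :
    HomotopicToId (F := Phi K I) (delta K I) (push K (σ ∘ τ)) := by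
  have h : push K (σ ∘ τ) = fun m => push K σ m ∘ₗ push K τ m :=
    funext fun m => DeRhamChains.push_comp τ σ m
  rw [h]
  exact HomotopicToId.comp (delta_comp_push σ) hσ hτ

/-- The constant map is a composite of maps `merge x y`, each moving one vertex to `x`. As `merge x
y` fixes `x`, the vertices moved earlier stay there. -/
theorem homotopicToId_const (x : I) : HomotopicToId (F := Phi K I) (delta K I) (push K fun _ :
    I => x) := by
  classical
  suffices ∀ S : Finset I, HomotopicToId (F := Phi K I) (delta K I)
    (push K fun i => if i ∈ S then x else i) by
    simpa using this Finset.univ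
  intro S
  induction S using Finset.induction_on with
  | empty => simpa using! homotopicToId_push_id (K := K) (I := I)
  | insert y S hy ih =>
    have h : (fun i => if i ∈ insert y S then x else i) =
        merge x y ∘ fun i => if i ∈ S then x else i := by
      funext i
      have hx : merge x y x = x := by
        by_cases h : x = y
        · subst h
          rw [merge, Function.comp_apply, splitNone_self]
          rfl
        · rw [merge, Function.comp_apply, splitNone_of_ne h]
          rfl
      rw [Function.comp_apply]
      by_cases hi : i ∈ S
      · rw [if_pos (Finset.mem_insert_of_mem hi), if_pos hi, hx]
      · rw [if_neg hi]
        by_cases hiy : i = y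
        · subst hiy
          rw [if_pos (Finset.mem_insert_self _ _), merge, Function.comp_apply, splitNone_self]
          rfl
        · rw [if_neg (by simp [hi, hiy]), merge, Function.comp_apply, splitNone_of_ne hiy]
          rfl
    rw [h]
    exact (homotopicToId_merge x y).push_comp ih

end HomotopicToId

/-! ### Chain complexes and quasi-isomorphisms -/

section QuasiIsomorphisms

set_option linter.unusedSectionVars false
set_option maxHeartbeats 2000000

open CategoryTheory

theorem nonempty_homotopy_id {R : Type*} [Ring R] {C : ChainComplex (ModuleCat.{v} R) ℕ}
    (f : C ⟶ C) (s : ∀ m, C.X m ⟶ C.X (m + 1)) (h0 : s 0 ≫ C.d 1 0 = 𝟙 _ - f.f 0)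
    (hs : ∀ m, s (m + 1) ≫ C.d (m + 2) (m + 1) + C.d (m + 1) m ≫ s m = 𝟙 _ - f.f (m + 1)) :
    Nonempty (Homotopy f (𝟙 C)) := by
  refine ⟨Homotopy.symm
    { hom := fun i j => if h : i + 1 = j then s i ≫ eqToHom (by rw [h]) else 0
      zero := fun i j hij => dif_neg hij
      comm := fun m => ?_ }⟩
  rw [Homotopy.prevD_chainComplex]
  rcases m with _ | m
  · rw [Homotopy.dNext_zero_chainComplex, dif_pos rfl, eqToHom_refl, Category.comp_id, h0]
    simp
  · rw [Homotopy.dNext_succ_chainComplex, dif_pos rfl, dif_pos rfl, eqToHom_refl, eqToHom_refl,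
      Category.comp_id, Category.comp_id, add_comm (C.d (m + 1) m ≫ s m), hs]
    simp

variable {K : Type u} [Field K] [CharZero K] {I J L : Type v} [Fintype I] [Fintype J] [Fintype L]

theorem PhiMap_id (hI hσ) : PhiMap K (id : I → I) hI hI hσ = 𝟙 (PhiComplex K I hI) :=
  HomologicalComplex.hom_ext _ _ fun m => congrArg ModuleCat.ofHom (push_id m)

theorem PhiMap_comp (σ : I → J) (τ : J → L) (hI hJ hL hσ hτ hστ) :
    PhiMap K (τ ∘ σ) hI hL hστ = PhiMap K σ hI hJ hσ ≫ PhiMap K τ hJ hL hτ :=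
  HomologicalComplex.hom_ext _ _ fun m => congrArg ModuleCat.ofHom (push_comp σ τ m)

theorem HomotopicToId.nonempty_homotopy {σ : I → I} (h : HomotopicToId (F := Phi K I) (delta K I)
    (push K σ))
    (hI hσ) : Nonempty (Homotopy (PhiMap K σ hI hI hσ) (𝟙 (PhiComplex K I hI))) := by
  obtain ⟨s, h0, hs⟩ := h
  refine nonempty_homotopy_id _ (fun m => ModuleCat.ofHom (s m)) ?_ fun m => ?_
  · rw [PhiComplex_d]
    exact congrArg ModuleCat.ofHom (LinearMap.ext h0)
  · rw [PhiComplex_d, PhiComplex_d]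
    exact congrArg ModuleCat.ofHom (LinearMap.ext (hs m))

/-- If `J` is nonempty, any constant `τ : J → I` makes both composites with `σ` constant, hence
homotopic to the identity. If `J` is empty then so is `I`, and both composites are identities. -/
theorem quasiIso_PhiMap (σ : I → J) (h : Nonempty J → Nonempty I) :
    QuasiIso (PhiMap K σ delta_comp_delta delta_comp_delta (delta_comp_push _)) := by
  obtain ⟨τ, h1, h2⟩ : ∃ τ : J → I,
      HomotopicToId (F := Phi K I) (delta K I) (push K (τ ∘ σ)) ∧
      HomotopicToId (F := Phi K J) (delta K J) (push K (σ ∘ τ)) := by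
    rcases isEmpty_or_nonempty J with hJ | hJ
    · have := σ.isEmpty
      refine ⟨isEmptyElim, ?_, ?_⟩
      · convert homotopicToId_push_id (K := K) (I := I)
      · convert homotopicToId_push_id (K := K) (I := J)
    · obtain ⟨x⟩ := h hJ
      exact ⟨fun _ => x, homotopicToId_const x, homotopicToId_const (σ x)⟩
  obtain ⟨e1⟩ := h1.nonempty_homotopy delta_comp_delta (delta_comp_push _)
  obtain ⟨e2⟩ := h2.nonempty_homotopy delta_comp_delta (delta_comp_push _)
  rw [PhiMap_comp σ τ delta_comp_delta delta_comp_delta delta_comp_delta (delta_comp_push _)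
    (delta_comp_push _)] at e1
  rw [PhiMap_comp τ σ delta_comp_delta delta_comp_delta delta_comp_delta (delta_comp_push _)
    (delta_comp_push _)] at e2
  exact (HomotopyEquiv.mk _ _ e1 e2).quasiIso_hom

end QuasiIsomorphisms

/-! ### The complex of a singleton -/

section Singleton

set_option linter.unusedSectionVars false
set_option maxHeartbeats 2000000

variable {K : Type u} [Field K] [CharZero K] {I : Type v} [Fintype I]

theorem exists_smul_one_eq [Subsingleton I] [Nonempty I] (f : P K I) : ∃ c : K, c • (1 : P K I) =
    f := by
  obtain ⟨p, rfl⟩ := P.mk_surjective K f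
  -- With a single variable, the relation `∑ t_i = 1` reads `t_i = 1`.
  have hX (i : I) : P.mk K I (X i) = 1 := by
    have h := P.mk_relation_mul K (1 : MvPolynomial I K)
    rw [mul_one, map_sub, map_one, sub_eq_zero, Fintype.sum_subsingleton _ i] at h
    exact h.symm
  induction p using MvPolynomial.induction_on with
  | C a => exact ⟨a, by rw [← Algebra.algebraMap_eq_smul_one, ← algebraMap_eq, AlgHom.commutes]⟩
  | add p q hp hq =>
    obtain ⟨c, hc⟩ := hp
    obtain ⟨c', hc'⟩ := hq
    exact ⟨c + c', by rw [add_smul, hc, hc', map_add]⟩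
  | mul_X p i hp =>
    obtain ⟨c, hc⟩ := hp
    exact ⟨c, by rw [map_mul, hX, mul_one, hc]⟩

theorem exists_smul_ιMulti_eq {V : Type*} [AddCommGroup V] [Module K V] (x : ⋀[K]^0 V) :
    ∃ c : K, c • exteriorPower.ιMulti K 0 Fin.elim0 = x := by
  have h : x ∈ Submodule.span K (Set.range (exteriorPower.ιMulti K 0 (M := V))) := by
    rw [exteriorPower.ιMulti_span]
    trivial
  rw [Set.range_unique] at h
  obtain ⟨c, hc⟩ := Submodule.mem_span_singleton.1 h
  exact ⟨c, by rw [← hc]; congr 2⟩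

theorem subsingleton_exteriorPower {V : Type*} [AddCommGroup V] [Module K V] [Subsingleton V]
    {m : ℕ} (hm : m ≠ 0) : Subsingleton (⋀[K]^m V) := by
  have h : (LinearMap.id : ⋀[K]^m V →ₗ[K] ⋀[K]^m V) = 0 := by
    refine exteriorPower.linearMap_ext (AlternatingMap.ext fun w => ?_)
    exact AlternatingMap.map_coord_zero _ (⟨0, Nat.pos_of_ne_zero hm⟩ : Fin m)
      (Subsingleton.elim _ _)
  exact subsingleton_of_forall_eq 0 fun x => LinearMap.congr_fun h x

theorem subsingleton_Tht [Subsingleton I] {m : ℕ} (hm : m ≠ 0) : Subsingleton (Tht K I m) := by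
  have : Subsingleton (W K I) := subsingleton_W
  have : Subsingleton (WDual K I) := subsingleton_of_forall_eq 0 fun f =>
    LinearMap.ext fun w => by rw [Subsingleton.elim w 0, map_zero, map_zero]
  have : Subsingleton (⋀[K]^m (WDual K I)) := subsingleton_exteriorPower hm
  have h : (LinearMap.id : Tht K I m →ₗ[K] Tht K I m) = 0 := by
    refine TensorProduct.ext' fun f a => ?_
    rw [Subsingleton.elim a 0, TensorProduct.tmul_zero, map_zero, map_zero]
  exact subsingleton_of_forall_eq 0 fun x => LinearMap.congr_fun h x

theorem subsingleton_Phi [Subsingleton I] {m : ℕ} (hm : m ≠ 0) : Subsingleton (Phi K I m) := by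
  have h : (LinearMap.id : Phi K I m →ₗ[K] Phi K I m) = 0 := by
    refine Phi.linearMap_ext fun A a => ?_
    have := subsingleton_Tht (K := K) (I := A.1) hm
    rw [Subsingleton.elim a 0, LinearMap.map_zero, LinearMap.map_zero, LinearMap.map_zero]
  exact subsingleton_of_forall_eq 0 fun x => LinearMap.congr_fun h x

theorem exists_smul_vertex_eq [Subsingleton I] (i : I) (α : Phi K I 0) :
    ∃ c : K, c • vertex K i = α := by
  suffices h : (Submodule.span K {vertex K i}).mkQ = 0 from
    Submodule.mem_span_singleton.1 ((Submodule.Quotient.mk_eq_zero _).1 (LinearMap.congr_fun h α))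
  refine Phi.linearMap_ext fun A a => (Submodule.Quotient.mk_eq_zero _).2 ?_
  obtain rfl : A = ⟨{i}, Finset.singleton_nonempty i⟩ := by
    refine Subtype.ext (Finset.eq_singleton_iff_unique_mem.2 ⟨?_, fun _ _ => Subsingleton.elim _ _⟩)
    obtain ⟨j, hj⟩ := A.2
    rwa [Subsingleton.elim i j]
  induction a using TensorProduct.induction_on with
  | zero => rw [LinearMap.map_zero]; exact Submodule.zero_mem _
  | add a b ha hb => rw [LinearMap.map_add]; exact Submodule.add_mem _ ha hb
  | tmul f a =>
    obtain ⟨c, rfl⟩ := exists_smul_one_eq f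
    obtain ⟨c', rfl⟩ := exists_smul_ιMulti_eq a
    rw [TensorProduct.tmul_smul, ← TensorProduct.smul_tmul', LinearMap.map_smul,
      LinearMap.map_smul]
    exact Submodule.smul_mem _ _ (Submodule.smul_mem _ _ (Submodule.mem_span_singleton_self _))

/-- Evaluation on the constant function `1` recovers `c` from `c • vertex K i`, which gives the
injectivity in `bijective_smul_vertex`. -/
theorem xi_vertex (i : I) :
    xi K I 0 (vertex K i) (1 ⊗ₜ[K] exteriorPower.ιMulti K 0 Fin.elim0) = 1 := by
  have h1 : integral K ({i} : Finset I) 1 = 1 := by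
    have := integral_mk (K := K) (I := ({i} : Finset I)) (monomial 0 1)
    rw [polyInt_monomial] at this
    simpa using this
  rw [vertex, xi_incl_apply, omPullback_tmul, map_one, exteriorPower.map_apply_ιMulti,
    current_tmul, mul_one, extPairing_apply, exteriorPower.pairingDual_ιMulti_ιMulti]
  simpa using h1

theorem bijective_smul_vertex [Subsingleton I] (i : I) :
    Function.Bijective fun c : K => c • vertex K i := by
  refine ⟨fun c c' h => ?_, exists_smul_vertex_eq i⟩
  have := LinearMap.congr_fun (congrArg (xi K I 0) h)
    (1 ⊗ₜ[K] exteriorPower.ιMulti K 0 Fin.elim0)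
  rwa [LinearMap.map_smul, LinearMap.map_smul, LinearMap.smul_apply, LinearMap.smul_apply,
    xi_vertex, smul_eq_mul, smul_eq_mul, mul_one, mul_one] at this

end Singleton

end DeRhamChains

end

theorem mainTheorem1 (K : Type u) [Field K] [CharZero K] :
    -- (a) `ξ_I` is injective, and its image is a subcomplex of the dual complex, with `δ` being the
    -- differential that the image inherits
    (∀ (I : Type v) [Fintype I] (m : ℕ),
      DeRhamChains.hatDelta K I m ∘ₗ DeRhamChains.hatDelta K I (m + 1) = 0 ∧
      Function.Injective (DeRhamChains.xi K I m) ∧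
      (LinearMap.range (DeRhamChains.xi K I (m + 1))).map (DeRhamChains.hatDelta K I m) ≤
        LinearMap.range (DeRhamChains.xi K I m) ∧
      DeRhamChains.xi K I m ∘ₗ DeRhamChains.delta K I m =
        DeRhamChains.hatDelta K I m ∘ₗ DeRhamChains.xi K I (m + 1)) ∧
    -- (b) `Φ_{I,*}` is a chain complex, covariantly functorial in `I`, compatibly with `ξ`, and
    -- the induced maps are quasi-isomorphisms
    (∃ (hd : ∀ (I : Type v) [Fintype I] (m : ℕ),
        DeRhamChains.delta K I m ∘ₗ DeRhamChains.delta K I (m + 1) = 0)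
      (hc : ∀ (I J : Type v) [Fintype I] [Fintype J] (σ : I → J) (m : ℕ),
        DeRhamChains.delta K J m ∘ₗ DeRhamChains.push K σ (m + 1) =
          DeRhamChains.push K σ m ∘ₗ DeRhamChains.delta K I m),
      (∀ (I : Type v) [Fintype I],
        DeRhamChains.PhiMap K (id : I → I) (hd I) (hd I) (hc I I id) =
          CategoryTheory.CategoryStruct.id (DeRhamChains.PhiComplex K I (hd I))) ∧
      (∀ (I J L : Type v) [Fintype I] [Fintype J] [Fintype L] (σ : I → J) (τ : J → L),
        DeRhamChains.PhiMap K (τ ∘ σ) (hd I) (hd L) (hc I L (τ ∘ σ)) =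
          CategoryTheory.CategoryStruct.comp
            (DeRhamChains.PhiMap K σ (hd I) (hd J) (hc I J σ))
            (DeRhamChains.PhiMap K τ (hd J) (hd L) (hc J L τ))) ∧
      (∀ (I J : Type v) [Fintype I] [Fintype J] (σ : I → J) (m : ℕ),
        DeRhamChains.xi K J m ∘ₗ DeRhamChains.push K σ m =
          (DeRhamChains.omPullback K σ m).dualMap ∘ₗ DeRhamChains.xi K I m) ∧
      (∀ (I J : Type v) [Fintype I] [Fintype J] (σ : I → J), (Nonempty J → Nonempty I) →
        QuasiIso (DeRhamChains.PhiMap K σ (hd I) (hd J) (hc I J σ)))) ∧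
    -- (c) for a singleton, `Φ_{1,*}` is `K` concentrated in degree `0`
    (∀ (I : Type v) [Fintype I] [Subsingleton I] (i : I),
      Function.Bijective (fun c : K => c • DeRhamChains.vertex K i) ∧
      ∀ m : ℕ, m ≠ 0 → Subsingleton (DeRhamChains.Phi K I m)) := by 
  refine ⟨fun I _ m => ⟨DeRhamChains.hatDelta_comp_hatDelta m, DeRhamChains.xi_injective m, ?_,
      DeRhamChains.xi_comp_delta m⟩,
    ⟨fun I _ m => DeRhamChains.delta_comp_delta m,
      fun I J _ _ σ m => DeRhamChains.delta_comp_push σ m, fun I _ => DeRhamChains.PhiMap_id _ _,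
      fun I J L _ _ _ σ τ => DeRhamChains.PhiMap_comp σ τ _ _ _ _ _ _,
      fun I J _ _ σ m => DeRhamChains.xi_push σ m,
      fun I J _ _ σ h => DeRhamChains.quasiIso_PhiMap σ h⟩,
    fun I _ _ i => ⟨DeRhamChains.bijective_smul_vertex i,
      fun m hm => DeRhamChains.subsingleton_Phi hm⟩⟩
  rintro _ ⟨_, ⟨α, rfl⟩, rfl⟩
  exact ⟨DeRhamChains.delta K I m α, LinearMap.congr_fun (DeRhamChains.xi_comp_delta m) α⟩
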